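/- A parameterized problem is a set $L\subseteq\{0,1\}^*\times\mathbb N$, where the second component of an instance $(x,k)$ is the parameter. An fpt-reduction from $L$ to $L'$ is a map $R:(x,k)\mapsto(x',k')$ such that $(x,k)\in L$ if and only if $R(x,k)\in L'$, $R$ is computable (on a random access machine with addition and subtraction, unit cost) in time $f(k)\cdot(|x|+1)^{c}$ for some computable function $f$ and some constant $c$, and $k'\le g(k)$ for some computable function $g$. The class $\mathrm W[1]$ consists of the parameterized problems that have an fpt-reduction to Weighted 2-CNF-Satisfiability (given a 2-CNF formula and $k$, is there a satisfying assignment with exactly $k$ variables true? parameter $k$). Digraphs are finite, without loops and parallel arcs. A digraph is Euler if its underlying undirected graph is connected and every vertex has in-degree equal to its out-degree. **Theorem.** The problem of deciding, given a digraph $D$ and an integer $k\ge 0$, whether $D$ has $k$ pairwise vertex-disjoint directed cycles, parameterized by $k$, is $\mathrm W[1]$-hard even when restricted to Euler digraphs: every parameterized problem in $\mathrm W[1]$ has an fpt-reduction to it such that every instance $(x,k)$ is mapped to an instance $(H,k')$ in which $H$ is an Euler digraph. -/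

import Mathlib

/-! ## Random access machines with a step count -/

namespace RAM

/-- Structured programs for a random access machine. The machine has registers, named by natural
numbers, and unbounded arrays, named by natural numbers; a program mentions only finitely many of
them. Every register and every array cell holds a natural number. -/
inductive Prog : Type
  /-- do nothing -/
  | skip : Prog
  /-- `reg r := c`, where the constant `c` is part of the program -/
  | const (r c : ℕ) : Prog
  /-- `reg r := reg a + reg b` -/
  | add (r a b : ℕ) : Prog
  /-- `reg r := max (reg a - reg b) 0` -/
  | sub (r a b : ℕ) : Prog
  /-- `reg r := arr A [reg i]` -/
  | load (r A i : ℕ) : Prog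
  /-- `arr A [reg i] := reg r` -/
  | store (A i r : ℕ) : Prog
  /-- first `p`, then `q` -/
  | seq (p q : Prog) : Prog
  /-- if `reg r ≠ 0` then `p` else `q` -/
  | cond (r : ℕ) (p q : Prog) : Prog
  /-- while `reg r ≠ 0` do `p` -/
  | loop (r : ℕ) (p : Prog) : Prog

/-- A memory state. -/
structure State where
  reg : ℕ → ℕ
  arr : ℕ → ℕ → ℕ

/-- The state after `reg r := v`. -/
def State.setReg (s : State) (r v : ℕ) : State :=
  { s with reg := Function.update s.reg r v }

/-- The state after `arr A [i] := v`. -/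
def State.setArr (s : State) (A i v : ℕ) : State :=
  { s with arr := Function.update s.arr A (Function.update (s.arr A) i v) }

/-- `Exec p s t s'`: started in state `s`, the program `p` halts after exactly `t` steps, in
state `s'`. Each elementary instruction and each test of a register counts as one step. -/
inductive Exec : Prog → State → ℕ → State → Prop
  | skip (s : State) : Exec .skip s 1 s
  | const (s : State) (r c : ℕ) : Exec (.const r c) s 1 (s.setReg r c)
  | add (s : State) (r a b : ℕ) : Exec (.add r a b) s 1 (s.setReg r (s.reg a + s.reg b))
  | sub (s : State) (r a b : ℕ) : Exec (.sub r a b) s 1 (s.setReg r (s.reg a - s.reg b))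
  | load (s : State) (r A i : ℕ) : Exec (.load r A i) s 1 (s.setReg r (s.arr A (s.reg i)))
  | store (s : State) (A i r : ℕ) : Exec (.store A i r) s 1 (s.setArr A (s.reg i) (s.reg r))
  | seq {p q : Prog} {s s' s'' : State} {t t' : ℕ} :
      Exec p s t s' → Exec q s' t' s'' → Exec (.seq p q) s (t + t') s''
  | condTrue {r : ℕ} {p q : Prog} {s s' : State} {t : ℕ} :
      s.reg r ≠ 0 → Exec p s t s' → Exec (.cond r p q) s (1 + t) s'
  | condFalse {r : ℕ} {p q : Prog} {s s' : State} {t : ℕ} :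
      s.reg r = 0 → Exec q s t s' → Exec (.cond r p q) s (1 + t) s'
  | loopDone {r : ℕ} {p : Prog} {s : State} :
      s.reg r = 0 → Exec (.loop r p) s 1 s
  | loopStep {r : ℕ} {p : Prog} {s s' s'' : State} {t t' : ℕ} :
      s.reg r ≠ 0 → Exec p s t s' → Exec (.loop r p) s' t' s'' →
      Exec (.loop r p) s (1 + t + t') s''

/-- The content of an array cell that holds a symbol of a bit string, or a blank. -/
def symbol : Option Bool → ℕ
  | none => 0
  | some false => 1
  | some true => 2

/-- The initial state on input `(x, k)`: register `0` holds `k`, array `0` holds the string `x`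
followed by blanks, and everything else is `0`. -/
def input (x : List Bool) (k : ℕ) : State where
  reg r := if r = 0 then k else 0
  arr A i := if A = 0 then symbol x[i]? else 0

/-- The state `s` shows the output `(y, k)`: register `0` holds `k`, and array `0` holds the
string `y` followed by a blank. -/
def IsOutput (s : State) (y : List Bool) (k : ℕ) : Prop :=
  s.reg 0 = k ∧ ∀ i ≤ y.length, s.arr 0 i = symbol y[i]?

end RAM

/-! ## Parameterized problems, fpt-reductions, and the class W[1] -/

namespace ParamComplexity

/-- An instance of a parameterized problem: a bit string, and the parameter. -/
abbrev Instance : Type := List Bool × ℕ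

/-- A parameterized problem is given by the set of its yes-instances. -/
abbrev Problem : Type := Set Instance

/-- The map `R` is computed by a program that on input `(x, k)` halts after at most
`f k * (|x| + 1) ^ c` steps, for a computable function `f` and a constant `c`. -/
def FPTComputable (R : Instance → Instance) : Prop :=
  ∃ (p : RAM.Prog) (f : ℕ → ℕ) (c : ℕ), Computable f ∧
    ∀ (x : List Bool) (k : ℕ), ∃ (t : ℕ) (s : RAM.State),
      RAM.Exec p (RAM.input x k) t s ∧ t ≤ f k * (x.length + 1) ^ c ∧
      RAM.IsOutput s (R (x, k)).1 (R (x, k)).2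

/-- The map `R` is an fpt-reduction from the problem `L` to the problem `L'`. -/
structure IsFPTReduction (R : Instance → Instance) (L L' : Problem) : Prop where
  mem_iff : ∀ w : Instance, w ∈ L ↔ R w ∈ L'
  computable : FPTComputable R
  param_le : ∃ g : ℕ → ℕ, Computable g ∧ ∀ (x : List Bool) (k : ℕ), (R (x, k)).2 ≤ g k

/-- The `m × m` bit matrix `M`, written row by row as a string of length `m * m`. -/
def encodeMatrix {m : ℕ} (M : Fin m → Fin m → Bool) : List Bool :=
  List.ofFn fun t : Fin (m * m) => M (finProdFinEquiv.symm t).1 (finProdFinEquiv.symm t).2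

/-- A literal over the variables `0, …, n - 1`: `(v, 0)` is the variable `v`, and `(v, 1)` is its
negation. -/
abbrev Literal (n : ℕ) : Type := Fin n × Fin 2

/-- A literal is true under an assignment `a`. -/
def Literal.Holds {n : ℕ} (a : Fin n → Bool) (l : Literal n) : Prop :=
  if l.2 = 0 then a l.1 = true else a l.1 = false

/-- A 2-CNF formula over the variables `0, …, n - 1`: a set of clauses `l₁ ∨ l₂`
(where `l₁ = l₂` is allowed, which gives the clauses of size one). -/
abbrev TwoCNF (n : ℕ) : Type := Finset (Literal n × Literal n)

/-- The assignment `a` satisfies the formula `φ`. -/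
def TwoCNF.SatisfiedBy {n : ℕ} (φ : TwoCNF n) (a : Fin n → Bool) : Prop :=
  ∀ c ∈ φ, c.1.Holds a ∨ c.2.Holds a

/-- A 2-CNF formula as a string: the matrix that says for each pair of literals
whether their disjunction is a clause. -/
def TwoCNF.encode {n : ℕ} (φ : TwoCNF n) : List Bool :=
  encodeMatrix fun i j : Fin (n * 2) => decide ((finProdFinEquiv.symm i, finProdFinEquiv.symm j) ∈ φ)

/-- Weighted 2-CNF-Satisfiability: does the formula have a satisfying assignment under which
exactly `k` variables are true? The parameter is `k`. -/
def weightedTwoCNFSat : Problem :=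
  {w | ∃ (n : ℕ) (φ : TwoCNF n), w.1 = φ.encode ∧
    ∃ a : Fin n → Bool, φ.SatisfiedBy a ∧ (Finset.univ.filter fun v => a v = true).card = w.2}

/-- The class W[1]: the parameterized problems that have an fpt-reduction to
Weighted 2-CNF-Satisfiability. -/
def W1 : Set Problem :=
  {L | ∃ R : Instance → Instance, IsFPTReduction R L weightedTwoCNFSat}

/-- The problem `P` is W[1]-hard even when it is restricted to the instances in `I`: every problem
in W[1] has an fpt-reduction to `P` all of whose values lie in `I`. -/
def IsW1HardOn (P : Problem) (I : Set Instance) : Prop :=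
  ∀ L ∈ W1, ∃ R : Instance → Instance, IsFPTReduction R L P ∧ ∀ w : Instance, R w ∈ I

end ParamComplexity

/-! ## Digraphs -/

namespace Digraph

/-- A directed cycle of `D`: a cyclic sequence of one or more distinct vertices, in which there is
an arc from each vertex to the next one. -/
structure IsDirectedCycle {V : Type*} (D : Digraph V) (c : Cycle V) : Prop where
  ne_nil : c ≠ Cycle.nil
  nodup : c.Nodup
  chain : c.Chain D.Adj

/-- `D` has `k` pairwise vertex-disjoint directed cycles. -/
def HasDisjointCycles {V : Type*} (D : Digraph V) (k : ℕ) : Prop :=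
  ∃ C : Fin k → Cycle V, (∀ i, D.IsDirectedCycle (C i)) ∧
    ∀ i j, i ≠ j → ∀ v, v ∈ C i → v ∉ C j

/-- `D` has no loops. (It cannot have parallel arcs.) -/
def Loopless {V : Type*} (D : Digraph V) : Prop :=
  ∀ v, ¬ D.Adj v v

/-- A digraph is Euler if it is connected (as an undirected graph) and the in-degree of each
vertex equals its out-degree. -/
structure IsEuler {V : Type*} (D : Digraph V) : Prop where
  connected : D.toSimpleGraphInclusive.Connected
  balanced : ∀ v : V, {u | D.Adj u v}.ncard = {u | D.Adj v u}.ncard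

open Classical in
/-- A digraph as a string: its adjacency matrix. -/
noncomputable def encode {n : ℕ} (D : Digraph (Fin n)) : List Bool :=
  ParamComplexity.encodeMatrix fun u v => decide (D.Adj u v)

/-- The vertex-disjoint directed cycles problem: does the given digraph have `k` vertex-disjoint
directed cycles? The parameter is `k`. -/
def vertexDisjointCycles : ParamComplexity.Problem :=
  {w | ∃ (n : ℕ) (D : Digraph (Fin n)), D.Loopless ∧ w.1 = D.encode ∧ D.HasDisjointCycles w.2}

/-- The instances whose digraph is an Euler digraph. -/
def eulerInstances : Set ParamComplexity.Instance :=
  {w | ∃ (n : ℕ) (D : Digraph (Fin n)), D.Loopless ∧ D.IsEuler ∧ w.1 = D.encode}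

end Digraph

/-! Every problem in W[1] reduces to Weighted 2-CNF-Satisfiability, so it suffices to reduce the
latter and to compose.

Gaps. An assignment of weight k to the variables 1, …, n is a sequence 0 = s_0 < s_1 < … < s_k <
s_{k+1} = n + 1, closed by n + 2, and is coded by its k + 2 gaps (s_i, s_{i+1}). A positive literal
is false iff its variable lies strictly inside a gap, a negative one iff its variable is the left
end of a gap. One gap thus witnesses that a literal is false, and two gaps witness that a 2-clause
is violated. So the formula amounts to a binary constraint satisfaction problem with k + 2 variables
and (n + 3)² values (`exists_isSolution`, `exists_assignment`).

Grid. For K variables and M values, each variable gets a row of M blocks of K positions, on two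
levels. There are K² roots, and every cycle meets one, so among K² disjoint cycles each has exactly
one root. The selector cycle of row i uses every position on one of the levels, except for at most
one block, that of the selected value. The verifier cycle of i < j must change levels in both rows,
and can do so only in the blocks left free by the selectors. It gets from row i to row j only by an
arc that exists for compatible values. The mates turn the remaining roots into 2-cycles, for the
sake of the count K². See `IsSolution.hasDisjointCycles` and
`exists_isSolution_of_hasDisjointCycles`.

Euler. Each arc u → v is completed to a closed walk through one common hub, which balances all
vertices. A cycle that uses a new arc contains the hub, so at most one of several disjoint cycles is
new; the 2-cycle of the hub and the spare vertex ensures that there can always be one. Hence k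
disjoint cycles become k + 1 (`HasDisjointCycles.eulerize`, `HasDisjointCycles.of_eulerize`).

Running time. The adjacency relation is a bounded arithmetical formula in the input. Such formulas
become expressions with bounded sums, which compile to machine programs of polynomial cost
(`compile_exec`, `isPoly_costBound`). In the composition, the intermediate instance is no longer
than the input plus the time spent on writing it (`Exec.length_output_le`). -/

namespace Digraph

variable {V W : Type*} {D : Digraph V} {D' : Digraph W} {c : Cycle V} {k : ℕ}

/-! ## Directed cycles -/

theorem exists_eq_cons_of_mem {v : V} (hv : v ∈ c) :
    ∃ l : List V, c = ((v :: l : List V) : Cycle V) := by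
  obtain ⟨l, rfl⟩ := Quot.exists_rep c
  obtain ⟨s, t, rfl⟩ := List.append_of_mem (show v ∈ l from hv)
  exact ⟨t ++ s, Cycle.coe_eq_coe.2 List.isRotated_append⟩

theorem IsDirectedCycle.exists_mem (hc : D.IsDirectedCycle c) : ∃ v, v ∈ c := by
  obtain ⟨l, rfl⟩ := Quot.exists_rep c
  rcases l with - | ⟨a, l⟩
  · exact (hc.ne_nil rfl).elim
  · exact ⟨a, List.mem_cons_self⟩

theorem IsDirectedCycle.exists_succ (hc : D.IsDirectedCycle c) {v : V} (hv : v ∈ c) :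
    ∃ w ∈ c, D.Adj v w := by
  obtain ⟨-, -, hch⟩ := hc
  obtain ⟨l, rfl⟩ := exists_eq_cons_of_mem hv
  rw [Cycle.chain_coe_cons] at hch
  rcases l with - | ⟨w, l⟩
  · exact ⟨v, by simp, by simpa using hch⟩
  · simp only [List.cons_append, List.isChain_cons_cons] at hch
    exact ⟨w, by simp, hch.1⟩

theorem IsDirectedCycle.exists_pred (hc : D.IsDirectedCycle c) {v : V} (hv : v ∈ c) :
    ∃ w ∈ c, D.Adj w v := by
  obtain ⟨-, -, hch⟩ := hc
  obtain ⟨l, rfl⟩ := exists_eq_cons_of_mem hv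
  rw [Cycle.chain_coe_cons] at hch
  rcases List.eq_nil_or_concat l with rfl | ⟨l, w, rfl⟩
  · exact ⟨v, by simp, by simpa using hch⟩
  · refine ⟨w, by simp, ?_⟩
    have : List.IsChain D.Adj ((v :: l) ++ [w, v]) := by simpa using hch
    simpa using (List.isChain_append.1 this).2.1

theorem chain_of_forall_mem {r s : V → V → Prop} (h : c.Chain r)
    (H : ∀ a ∈ c, ∀ b ∈ c, r a b → s a b) : c.Chain s := by
  induction c using Quotient.inductionOn' with | _ l
  rcases l with - | ⟨a, l⟩
  · trivial
  · rw [Cycle.mk''_eq_coe, Cycle.chain_coe_cons] at h ⊢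
    refine h.imp_of_mem_imp fun x y hx hy => H x ?_ y ?_
    · change x ∈ a :: l
      simp at hx ⊢; tauto
    · change y ∈ a :: l
      simp at hy ⊢; tauto

theorem IsDirectedCycle.map (hc : D.IsDirectedCycle c) {f : V → W}
    (hf : ∀ u ∈ c, ∀ v ∈ c, D.Adj u v → D'.Adj (f u) (f v))
    (hinj : ∀ u ∈ c, ∀ v ∈ c, f u = f v → u = v) : D'.IsDirectedCycle (c.map f) where
  ne_nil := by simpa using hc.ne_nil
  nodup := by
    have := hc.nodup
    induction c using Quotient.inductionOn' with | _ l
    rw [Cycle.mk''_eq_coe] at *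
    simp only [Cycle.map_coe, Cycle.nodup_coe_iff, Cycle.mem_coe_iff] at *
    exact List.Nodup.map_on (fun x hx y hy => hinj x hx y hy) this
  chain := (Cycle.chain_map f).2 (chain_of_forall_mem hc.chain hf)

/-- A family of disjoint cycles is carried along a map that preserves arcs between vertices of the
cycles and is injective on them. -/
theorem hasDisjointCycles_of_map {C : Fin k → Cycle V} (hC : ∀ i, D.IsDirectedCycle (C i))
    (hd : ∀ i j, i ≠ j → ∀ v, v ∈ C i → v ∉ C j) (f : V → W)
    (hf : ∀ i, ∀ u ∈ C i, ∀ v ∈ C i, D.Adj u v → D'.Adj (f u) (f v))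
    (hinj : ∀ i j, ∀ u ∈ C i, ∀ v ∈ C j, f u = f v → u = v) : D'.HasDisjointCycles k := by
  refine ⟨fun i => (C i).map f, fun i => (hC i).map (hf i) (hinj i i), fun i j hij v hv hv' => ?_⟩
  rw [Cycle.mem_map] at hv hv'
  obtain ⟨a, ha, rfl⟩ := hv
  obtain ⟨b, hb, hab⟩ := hv'
  exact hd i j hij a ha (hinj i j a ha b hb hab.symm ▸ hb)

/-- A vertex of a directed cycle has an out-neighbour, so collisions among vertices without outgoing
arcs do no harm. -/
theorem HasDisjointCycles.map (h : D.HasDisjointCycles k) (f : V → W)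
    (hf : ∀ u v, D.Adj u v → D'.Adj (f u) (f v))
    (hinj : Set.InjOn f {v | ∃ w, D.Adj v w}) : D'.HasDisjointCycles k := by
  obtain ⟨C, hC, hd⟩ := h
  refine hasDisjointCycles_of_map hC hd f (fun _ u _ v _ => hf u v) fun i j u hu v hv => ?_
  obtain ⟨a, -, ha⟩ := (hC i).exists_succ hu
  obtain ⟨b, -, hb⟩ := (hC j).exists_succ hv
  exact hinj ⟨a, ha⟩ ⟨b, hb⟩

/-! ## Making a digraph Euler -/

/-- The vertices of the Eulerian extension of a digraph on `V`: the vertices of the digraph, for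
each pair of vertices one vertex on a path to the hub and one on a path from the hub,
the hub, and a spare vertex. -/
abbrev EulerVertex (V : Type*) : Type _ := V ⊕ ((V × V) ⊕ ((V × V) ⊕ Fin 2))

namespace EulerVertex
/-- A vertex of the digraph. -/
abbrev base (v : V) : EulerVertex V := .inl v
/-- The vertex on the path to the hub for a pair of vertices. -/
abbrev toHub (u v : V) : EulerVertex V := .inr (.inl (u, v))
/-- The vertex on the path from the hub for a pair of vertices. -/
abbrev fromHub (u v : V) : EulerVertex V := .inr (.inr (.inl (u, v)))
/-- The hub. -/
abbrev hub : EulerVertex V := .inr (.inr (.inr 0))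
/-- The spare vertex. -/
abbrev spare : EulerVertex V := .inr (.inr (.inr 1))
end EulerVertex

open EulerVertex

/-- The arcs of the Eulerian extension of `D`: each arc `u → v` of `D` (and each trivial pair
`u = v`) is completed to a closed walk through the hub. -/
inductive EulerAdj (D : Digraph V) : EulerVertex V → EulerVertex V → Prop
  | arc {u v : V} : D.Adj u v → EulerAdj D (base u) (base v)
  | leave {u v : V} : u = v ∨ D.Adj u v → EulerAdj D (base v) (toHub u v)
  | arrive (u v : V) : EulerAdj D (toHub u v) hub
  | back {u v : V} : ¬(u = v ∨ D.Adj u v) → EulerAdj D hub (toHub u v)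
  | depart (u v : V) : EulerAdj D hub (fromHub u v)
  | enter {u v : V} : u = v ∨ D.Adj u v → EulerAdj D (fromHub u v) (base u)
  | goBack {u v : V} : ¬(u = v ∨ D.Adj u v) → EulerAdj D (fromHub u v) hub
  | toSpare : EulerAdj D hub spare
  | ofSpare : EulerAdj D spare hub

/-- The Eulerian extension of a digraph. -/
def eulerize (D : Digraph V) : Digraph (EulerVertex V) := ⟨EulerAdj D⟩

theorem eulerize_loopless (hD : D.Loopless) : D.eulerize.Loopless := by
  intro v h
  rcases v with v | ⟨u, v⟩ | ⟨u, v⟩ | i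
  · cases h with | arc h => exact hD _ h
  · cases h
  · cases h
  · fin_cases i <;> cases h

theorem HasDisjointCycles.eulerize (h : D.HasDisjointCycles k) :
    D.eulerize.HasDisjointCycles (k + 1) := by
  obtain ⟨C, hC, hd⟩ := h
  have hmem : ∀ i v, v ∈ (C i).map (base : V → EulerVertex V) → ∃ a ∈ C i, v = base a := by
    intro i v hv
    obtain ⟨a, ha, rfl⟩ := Cycle.mem_map.1 hv
    exact ⟨a, ha, rfl⟩
  refine ⟨Fin.cons (([hub, spare] : List (EulerVertex V)) : Cycle _)
    fun i => (C i).map base, ?_, ?_⟩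
  · refine Fin.cases ⟨?_, ?_, ?_⟩ fun i => (hC i).map (fun u _ v _ h => .arc h) ?_
    · simp
    · simp
    · simp only [Fin.cons_zero, Cycle.chain_coe_cons]
      simp only [List.cons_append, List.nil_append, List.isChain_cons_cons,
        List.isChain_singleton, and_true]
      exact ⟨.toSpare, .ofSpare⟩
    · exact fun u _ v _ h => Sum.inl_injective h
  · refine Fin.cases (Fin.cases (by simp) fun j _ v hv hv' => ?_) fun i =>
      Fin.cases (fun _ v hv hv' => ?_) fun j hij v hv hv' => ?_
    · obtain ⟨a, -, rfl⟩ := hmem _ _ hv'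
      simp at hv
    · obtain ⟨a, -, rfl⟩ := hmem _ _ hv
      simp at hv'
    · obtain ⟨a, ha, rfl⟩ := hmem _ _ hv
      obtain ⟨b, hb, e⟩ := hmem _ _ hv'
      obtain rfl := Sum.inl_injective e
      exact hd i j (fun h => hij (h ▸ rfl)) _ ha hb

/-- A cycle that avoids the hub stays in the original digraph: `toHub` vertices and the spare vertex
have no out-neighbour but the hub, and `fromHub` vertices have no in-neighbour but the hub. At most
one of the cycles passes through the hub, and this one is dropped. -/
theorem HasDisjointCycles.of_eulerize (h : D.eulerize.HasDisjointCycles (k + 1)) :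
    D.HasDisjointCycles k := by
  obtain ⟨C, hC, hd⟩ := h
  obtain ⟨i₀, hi₀⟩ : ∃ i₀, ∀ i, hub ∈ C i → i = i₀ := by
    by_cases h : ∃ i, hub ∈ C i
    · obtain ⟨i₀, hi₀⟩ := h
      exact ⟨i₀, fun i hi => by_contra fun hne => hd i i₀ hne _ hi hi₀⟩
    -- If no cycle meets the hub, any of them can be dropped.
    · exact ⟨0, fun i hi => (h ⟨i, hi⟩).elim⟩
  have hbase : ∀ (i : Fin k) v, v ∈ C (i₀.succAbove i) → ∃ a, v = base a := by
    intro i v hv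
    have hhub : hub ∉ C (i₀.succAbove i) := fun h => Fin.succAbove_ne i₀ i (hi₀ _ h)
    obtain ⟨w, hw, hvw⟩ := (hC _).exists_succ hv
    obtain ⟨w', hw', hvw'⟩ := (hC _).exists_pred hv
    rcases v with v | ⟨u, v⟩ | ⟨u, v⟩ | j
    · exact ⟨v, rfl⟩
    · cases hvw with | arrive => exact (hhub hw).elim
    · cases hvw' with | depart => exact (hhub hw').elim
    · fin_cases j
      · exact (hhub hv).elim
      · cases hvw with | ofSpare => exact (hhub hw).elim
  -- The map back to `V` needs a value for the new vertices. If `V` is empty, no cycle can remain,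
  -- so `k = 0`.
  rcases isEmpty_or_nonempty V with hV | ⟨⟨v₀⟩⟩
  · rcases k with - | k
    · exact ⟨Fin.elim0, fun i => i.elim0, fun i => i.elim0⟩
    · obtain ⟨v, hv⟩ := (hC (i₀.succAbove 0)).exists_mem
      obtain ⟨a, -⟩ := hbase 0 v hv
      exact hV.elim a
  · refine hasDisjointCycles_of_map (fun i => hC (i₀.succAbove i))
      (fun i j hij => hd _ _ fun h => hij (Fin.succAbove_right_injective h))
      (Sum.elim id fun _ => v₀) ?_ ?_
    · intro i u hu v hv h
      obtain ⟨a, rfl⟩ := hbase i u hu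
      obtain ⟨b, rfl⟩ := hbase i v hv
      cases h with | arc h => exact h
    · intro i j u hu v hv h
      obtain ⟨a, rfl⟩ := hbase i u hu
      obtain ⟨b, rfl⟩ := hbase j v hv
      exact congrArg _ h

/-- The trivial pairs `(v, v)` link every vertex to the hub, even one that is isolated in `D`. -/
theorem eulerize_connected : D.eulerize.toSimpleGraphInclusive.Connected := by
  have key : ∀ x y, x ≠ y → D.eulerize.Adj x y ∨ D.eulerize.Adj y x →
      D.eulerize.toSimpleGraphInclusive.Reachable x y := fun x y hne h =>
    SimpleGraph.Adj.reachable (by simpa [toSimpleGraphInclusive, hne] using h)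
  have hto : ∀ u v : V, D.eulerize.toSimpleGraphInclusive.Reachable (toHub u v) hub :=
    fun u v => key _ _ (by simp) (.inl (.arrive u v))
  rw [SimpleGraph.connected_iff_exists_forall_reachable]
  refine ⟨hub, fun x => SimpleGraph.Reachable.symm ?_⟩
  rcases x with v | ⟨u, v⟩ | ⟨u, v⟩ | i
  · exact (key _ _ (by simp) (.inl (.leave (.inl rfl)))).trans (hto v v)
  · exact hto u v
  · exact key _ _ (by simp) (.inr (.depart u v))
  · fin_cases i
    · exact .rfl
    · exact key _ _ (by simp) (.inl .ofSpare)

theorem ncard_eq_of_swap {α : Type*} (S T : Set α) (f g : α → α) (hf : ∀ x ∈ S, f x ∈ T)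
    (hg : ∀ x ∈ T, g x ∈ S) (hgf : ∀ x ∈ S, g (f x) = x) (hfg : ∀ x ∈ T, f (g x) = x) :
    S.ncard = T.ncard :=
  Set.ncard_congr' ⟨fun x => ⟨f x, hf x x.2⟩, fun x => ⟨g x, hg x x.2⟩,
    fun x => Subtype.ext (hgf x x.2), fun x => Subtype.ext (hfg x x.2)⟩

open Classical in
-- At a vertex `v` of `D`, each arc in is matched with the next arc of its closed walk: `base u`
-- with `toHub u v`, `fromHub v w` with `base w`, and `fromHub v v` with `toHub v v` for the trivial
-- pair. Without loops, these cases do not overlap.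
theorem eulerize_balanced (hD : D.Loopless) (x : EulerVertex V) :
    {u | D.eulerize.Adj u x}.ncard = {u | D.eulerize.Adj x u}.ncard := by
  rcases x with v | ⟨u, v⟩ | ⟨u, v⟩ | i
  · refine ncard_eq_of_swap _ _
      (fun x => match x with
        | .inl u => toHub u v
        | .inr (.inr (.inl (_, w))) => if v = w then toHub v v else base w
        | y => y)
      (fun x => match x with
        | .inl u => fromHub v u
        | .inr (.inl (w, _)) => if v = w then fromHub v v else base w
        | y => y) ?_ ?_ ?_ ?_
    · intro x hx
      cases hx with
      | arc h => exact .leave (.inr h)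
      | @enter _ w h =>
        dsimp only
        split_ifs with hvw
        · exact .leave (.inl rfl)
        · exact .arc (h.resolve_left hvw)
    · intro x hx
      cases hx with
      | arc h => exact .enter (.inr h)
      | @leave w _ h =>
        dsimp only
        split_ifs with hvw
        · exact .enter (.inl rfl)
        · exact .arc (h.resolve_left (Ne.symm hvw))
    · intro x hx
      cases hx with
      | @arc u _ h => simp [show v ≠ u by rintro rfl; exact hD _ h]
      | @enter _ w h => by_cases hvw : v = w <;> simp [hvw]
    · intro x hx
      cases hx with
      | @arc _ u h => simp [show v ≠ u by rintro rfl; exact hD _ h]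
      | @leave w _ h => by_cases hvw : v = w <;> simp [hvw]
  · by_cases h : u = v ∨ D.Adj u v
    · have h₁ : {x | D.eulerize.Adj x (toHub u v)} = {base v} := by
        ext x
        refine ⟨fun hx => ?_, ?_⟩
        · cases hx with
          | leave _ => rfl
          | back h' => exact (h' h).elim
        · rintro rfl
          exact .leave h
      have h₂ : {x | D.eulerize.Adj (toHub u v) x} = {hub} := by
        ext x
        refine ⟨fun hx => ?_, ?_⟩
        · cases hx with | arrive => rfl
        · rintro rfl
          exact .arrive u v
      rw [h₁, h₂, Set.ncard_singleton, Set.ncard_singleton]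
    · congr 1
      ext x
      refine ⟨fun hx => ?_, fun hx => ?_⟩
      · cases hx with
        | leave h' => exact (h h').elim
        | back _ => exact .arrive u v
      · cases hx with | arrive => exact .back h
  · by_cases h : u = v ∨ D.Adj u v
    · have h₁ : {x | D.eulerize.Adj (fromHub u v) x} = {base u} := by
        ext x
        refine ⟨fun hx => ?_, ?_⟩
        · cases hx with
          | enter _ => rfl
          | goBack h' => exact (h' h).elim
        · rintro rfl
          exact .enter h
      have h₂ : {x | D.eulerize.Adj x (fromHub u v)} = {hub} := by
        ext x
        refine ⟨fun hx => ?_, ?_⟩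
        · cases hx with | depart => rfl
        · rintro rfl
          exact .depart u v
      rw [h₁, h₂, Set.ncard_singleton, Set.ncard_singleton]
    · congr 1
      ext x
      refine ⟨fun hx => ?_, fun hx => ?_⟩
      · cases hx with | depart => exact .goBack h
      · cases hx with
        | enter h' => exact (h h').elim
        | goBack _ => exact .depart u v
  · fin_cases i
    -- Exchanging the two path vertices of each pair turns the arcs into the hub into the arcs out
    -- of it.
    · let σ : EulerVertex V → EulerVertex V := fun x => match x with
        | .inr (.inl (u, v)) => fromHub u v
        | .inr (.inr (.inl (u, v))) => toHub u v
        | y => y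
      have hσ : ∀ x, σ (σ x) = x := by
        rintro (v | ⟨u, v⟩ | ⟨u, v⟩ | i) <;> rfl
      refine ncard_eq_of_swap _ _ σ σ ?_ ?_ (fun x _ => hσ x) (fun x _ => hσ x)
      · intro x hx
        cases hx with
        | arrive u v => exact .depart u v
        | goBack h => exact .back h
        | ofSpare => exact .toSpare
      · intro x hx
        cases hx with
        | depart u v => exact .arrive u v
        | back h => exact .goBack h
        | toSpare => exact .ofSpare
    · congr 1
      ext x
      refine ⟨fun hx => ?_, fun hx => ?_⟩
      · cases hx with | toSpare => exact .ofSpare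
      · cases hx with | ofSpare => exact .toSpare

theorem eulerize_isEuler (hD : D.Loopless) : D.eulerize.IsEuler :=
  ⟨eulerize_connected, eulerize_balanced hD⟩

/-! ## Isomorphic digraphs -/

theorem Loopless.of_iso (e : W ≃ V) (he : ∀ x y, D'.Adj x y ↔ D.Adj (e x) (e y))
    (h : D.Loopless) : D'.Loopless :=
  fun v hv => h (e v) ((he v v).1 hv)

theorem IsEuler.of_iso (e : W ≃ V) (he : ∀ x y, D'.Adj x y ↔ D.Adj (e x) (e y))
    (h : D.IsEuler) : D'.IsEuler where
  connected := by
    have i : D'.toSimpleGraphInclusive ≃g D.toSimpleGraphInclusive :=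
      ⟨e, fun {a b} => by simp [toSimpleGraphInclusive, he]⟩
    exact i.connected_iff.2 h.connected
  balanced v := by
    have h₁ : {u | D'.Adj u v} = e ⁻¹' {u | D.Adj u (e v)} := by ext; simp [he]
    have h₂ : {u | D'.Adj v u} = e ⁻¹' {u | D.Adj (e v) u} := by ext; simp [he]
    rw [h₁, h₂, Set.ncard_preimage_of_injective_subset_range e.injective (by simp),
      Set.ncard_preimage_of_injective_subset_range e.injective (by simp), h.balanced]

theorem hasDisjointCycles_congr (e : W ≃ V) (he : ∀ x y, D'.Adj x y ↔ D.Adj (e x) (e y)) :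
    D'.HasDisjointCycles k ↔ D.HasDisjointCycles k :=
  ⟨fun h => h.map e (fun x y => (he x y).1) e.injective.injOn,
    fun h => h.map e.symm (fun x y hxy => by simpa [he] using hxy) e.symm.injective.injOn⟩

end Digraph

namespace Digraph

/-! ## Binary constraint satisfaction as a disjoint cycles problem -/

/-- `x` solves the constraint satisfaction problem with variables `0, …, K - 1` that all have the
domain `0, …, M - 1`, and the constraint `compat i u j v` for `i < j`. -/
def IsSolution (K M : ℕ) (compat : ℕ → ℕ → ℕ → ℕ → Prop) (x : ℕ → ℕ) : Prop :=
  ∀ i j, i < j → j < K → x i < M ∧ x j < M ∧ compat i (x i) j (x j)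

/-- The vertices of the digraph of a constraint satisfaction problem. -/
inductive GridVertex : Type
  /-- the vertex that identifies the selector cycle (`i = j`) or the verifier cycle (`i < j`) -/
  | root (i j : ℕ)
  /-- a companion of the root for `j < i` -/
  | mate (i j : ℕ)
  /-- the vertex of row `i` at position `t` on level `l` -/
  | node (i t l : ℕ)

open GridVertex

/-- The arcs of the digraph of a constraint satisfaction problem. A selector cycle runs through its
row, first on level `0` and then on level `1`, and skips the block of `K` positions of the value
that it selects; a verifier cycle passes from level `0` to level `1` in two blocks. -/
inductive GridAdj (K M : ℕ) (compat : ℕ → ℕ → ℕ → ℕ → Prop) : GridVertex → GridVertex → Prop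
  | start {i : ℕ} : i < K → GridAdj K M compat (root i i) (node i 0 0)
  | finish {i t : ℕ} : i < K → t + 1 = M * K → GridAdj K M compat (node i t 1) (root i i)
  | step {i t l : ℕ} : i < K → t + 1 < M * K → l < 2 →
      GridAdj K M compat (node i t l) (node i (t + 1) l)
  | skip {i t w : ℕ} : i < K → w + 2 < M → t + 1 = (w + 1) * K →
      GridAdj K M compat (node i t 0) (node i ((w + 2) * K) 1)
  | down {i t : ℕ} : i < K → t < M * K → GridAdj K M compat (node i t 0) (node i t 1)
  | enter {i j u : ℕ} : i < j → j < K → u < M →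
      GridAdj K M compat (root i j) (node i (u * K + j) 0)
  | cross {i j u v : ℕ} : i < j → j < K → u < M → v < M → compat i u j v →
      GridAdj K M compat (node i (u * K + j) 1) (node j (v * K + i) 0)
  | exit {i j v : ℕ} : i < j → j < K → v < M →
      GridAdj K M compat (node j (v * K + i) 1) (root i j)
  | toMate {i j : ℕ} : j < i → i < K → GridAdj K M compat (root i j) (mate i j)
  | ofMate {i j : ℕ} : j < i → i < K → GridAdj K M compat (mate i j) (root i j)

/-- The digraph of a constraint satisfaction problem. -/
def grid (K M : ℕ) (compat : ℕ → ℕ → ℕ → ℕ → Prop) : Digraph GridVertex := ⟨GridAdj K M compat⟩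

variable {K M : ℕ} {compat : ℕ → ℕ → ℕ → ℕ → Prop}

/-! ### The grid is acyclic away from the roots -/

theorem grid_loopless : (grid K M compat).Loopless := by
  have : ∀ p q, GridAdj K M compat p q → p ≠ q := by
    intro p q h
    cases h <;> simp
  exact fun v h => this v v h rfl

theorem mul_add_lt_mul {u M j K : ℕ} (hu : u < M) (hj : j < K) : u * K + j < M * K :=
  calc u * K + j < u * K + K := by omega
    _ = (u + 1) * K := by ring
    _ ≤ M * K := Nat.mul_le_mul_right _ hu

/-- The position of a vertex in a linear order in which all arcs between nodes go up. -/
def nodeRank (K M : ℕ) : GridVertex → ℕ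
  | node i t l => (i * (M * K) + t) * 2 + l
  | _ => 0

/-- The vertex is a node. -/
def IsNode : GridVertex → Prop
  | node _ _ _ => True
  | _ => False

/-- The rank orders nodes lexicographically by row, position and level. Only `cross` changes the
row, to a larger one; the other arcs advance the position, or keep it and raise the level. -/
theorem GridAdj.nodeRank_lt {p q : GridVertex} (h : GridAdj K M compat p q) (hp : IsNode p)
    (hq : IsNode q) : nodeRank K M p < nodeRank K M q := by
  cases h with
  | start => exact hp.elim
  | finish => exact hq.elim
  | step => simp only [nodeRank]; omega
  | @skip i t w _ _ ht =>
    simp only [nodeRank]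
    have : (w + 2) * K = (w + 1) * K + K := by ring
    omega
  | down => simp only [nodeRank]; omega
  | enter => exact hp.elim
  | @cross i j u v hij hj hu hv =>
    simp only [nodeRank]
    have h₁ := mul_add_lt_mul hu hj
    have h₂ : (i + 1) * (M * K) ≤ j * (M * K) := Nat.mul_le_mul_right _ hij
    have h₃ : (i + 1) * (M * K) = i * (M * K) + M * K := by ring
    omega
  | exit => exact hq.elim
  | toMate => exact hp.elim
  | ofMate => exact hp.elim

/-- Along a cycle of nodes alone the rank would increase forever. A mate has only a root as
neighbour. -/
theorem exists_root_mem {c : Cycle GridVertex} (hc : (grid K M compat).IsDirectedCycle c) :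
    ∃ i j, i < K ∧ j < K ∧ root i j ∈ c := by
  by_contra! hno
  have hnode : ∀ p ∈ c, IsNode p := by
    intro p hp
    obtain ⟨q, hq, hpq⟩ := hc.exists_succ hp
    cases hpq with
    | start h => exact (hno _ _ h h hp).elim
    | enter h₁ h₂ => exact (hno _ _ (h₁.trans h₂) h₂ hp).elim
    | toMate h₁ h₂ => exact (hno _ _ h₂ (h₁.trans h₂) hp).elim
    | ofMate h₁ h₂ => exact (hno _ _ h₂ (h₁.trans h₂) hq).elim
    | _ => trivial
  have hch : c.Chain (fun p q => nodeRank K M p < nodeRank K M q) :=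
    chain_of_forall_mem hc.chain fun p hp q hq h =>
      GridAdj.nodeRank_lt h (hnode p hp) (hnode q hq)
  have : IsTrans GridVertex (fun p q => nodeRank K M p < nodeRank K M q) :=
    ⟨fun _ _ _ => lt_trans⟩
  obtain ⟨p, hp⟩ := hc.exists_mem
  exact lt_irrefl _ (Cycle.chain_iff_pairwise.1 hch p hp p hp)

/-- A family of `K * K` disjoint cycles has for each root exactly one cycle through it. -/
theorem exists_cycle_of_root (h : (grid K M compat).HasDisjointCycles (K * K)) :
    ∃ C : ℕ → ℕ → Cycle GridVertex, (∀ i j, i < K → j < K →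
      (grid K M compat).IsDirectedCycle (C i j) ∧ root i j ∈ C i j) ∧
      ∀ i j i' j', i < K → j < K → i' < K → j' < K → ∀ p, p ∈ C i j → p ∈ C i' j' →
        i = i' ∧ j = j' := by
  obtain ⟨C, hC, hd⟩ := h
  choose r s hr hs hrs using fun a => exists_root_mem (hC a)
  let F : Fin (K * K) → Fin K × Fin K := fun a => (⟨r a, hr a⟩, ⟨s a, hs a⟩)
  have hF : F.Injective := by
    intro a b hab
    by_contra hne
    simp only [F, Prod.mk.injEq, Fin.mk.injEq] at hab
    have := hrs b
    rw [← hab.1, ← hab.2] at this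
    exact hd a b hne _ (hrs a) this
  -- There are as many cycles as roots, so choosing a root on each cycle is a bijection.
  have hF' : F.Surjective :=
    (Finite.injective_iff_surjective_of_equiv finProdFinEquiv.symm).1 hF
  choose G hG using hF'
  have hG' : ∀ i j (hi : i < K) (hj : j < K), r (G (⟨i, hi⟩, ⟨j, hj⟩)) = i ∧
      s (G (⟨i, hi⟩, ⟨j, hj⟩)) = j := by
    intro i j hi hj
    have := hG (⟨i, hi⟩, ⟨j, hj⟩)
    simpa [F] using this
  refine ⟨fun i j => if h : i < K ∧ j < K then C (G (⟨i, h.1⟩, ⟨j, h.2⟩)) else Cycle.nil,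
    ?_, ?_⟩
  · intro i j hi hj
    simp only [hi, hj, and_self, dite_true]
    refine ⟨hC _, ?_⟩
    have := hrs (G (⟨i, hi⟩, ⟨j, hj⟩))
    rwa [(hG' i j hi hj).1, (hG' i j hi hj).2] at this
  · intro i j i' j' hi hj hi' hj' p hp hp'
    simp only [hi, hj, hi', hj', and_self, dite_true] at hp hp'
    have e : G (⟨i, hi⟩, ⟨j, hj⟩) = G (⟨i', hi'⟩, ⟨j', hj'⟩) :=
      by_contra fun hne => hd _ _ hne p hp hp'
    have h₁ := hG' i j hi hj
    rw [e, (hG' i' j' hi' hj').1, (hG' i' j' hi' hj').2] at h₁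
    exact ⟨h₁.1.symm, h₁.2.symm⟩

/-! ### Leaving a set of vertices along a cycle -/

section Escape

variable {V : Type*} {D : Digraph V} {c : Cycle V}

/-- If no arc left `P`, the transitive relation `P a → P b` would hold along the cycle and hence
between any two of its vertices. -/
theorem IsDirectedCycle.exists_adj_of_mem (hc : D.IsDirectedCycle c) (P : V → Prop) {u v : V}
    (hu : u ∈ c) (hv : v ∈ c) (hPu : P u) (hPv : ¬ P v) :
    ∃ a ∈ c, ∃ b ∈ c, D.Adj a b ∧ P a ∧ ¬ P b := by
  by_contra! hno
  have hch : c.Chain (fun a b => P a → P b) :=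
    chain_of_forall_mem hc.chain fun a ha b hb h => hno a ha b hb h
  have : IsTrans V (fun a b => P a → P b) := ⟨fun _ _ _ h₁ h₂ h => h₂ (h₁ h)⟩
  exact hPv (Cycle.chain_iff_pairwise.1 hch u hu v hv hPu)

end Escape

/-- Being a node of row `r` at a position and level that satisfy `P`. -/
def NodeWith (r : ℕ) (P : ℕ → ℕ → Prop) (p : GridVertex) : Prop :=
  ∃ t l, p = node r t l ∧ P t l

/-- A directed cycle of the grid that contains the root `(i, j)`, where `i ≤ j`, and no other. -/
structure IsRootCycle (K M : ℕ) (compat : ℕ → ℕ → ℕ → ℕ → Prop) (i j : ℕ)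
    (c : Cycle GridVertex) : Prop where
  isDirectedCycle : (grid K M compat).IsDirectedCycle c
  mem : root i j ∈ c
  le : i ≤ j
  lt : j < K
  unique : ∀ i' j', root i' j' ∈ c → i' = i ∧ j' = j

namespace IsRootCycle

variable {c : Cycle GridVertex} {i j : ℕ}

theorem exists_succ (h : IsRootCycle K M compat i j c) {p : GridVertex} (hp : p ∈ c) :
    ∃ q ∈ c, GridAdj K M compat p q := h.isDirectedCycle.exists_succ hp

theorem exists_pred (h : IsRootCycle K M compat i j c) {p : GridVertex} (hp : p ∈ c) :
    ∃ q ∈ c, GridAdj K M compat q p := h.isDirectedCycle.exists_pred hp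

theorem exists_leave (h : IsRootCycle K M compat i j c) (P : GridVertex → Prop)
    {p : GridVertex} (hp : p ∈ c) (hP : P p) (hroot : ¬ P (root i j)) :
    ∃ a ∈ c, ∃ b ∈ c, GridAdj K M compat a b ∧ P a ∧ ¬ P b :=
  h.isDirectedCycle.exists_adj_of_mem P hp h.mem hP hroot

theorem exists_arrive (h : IsRootCycle K M compat i j c) (P : GridVertex → Prop)
    {p : GridVertex} (hp : p ∈ c) (hP : P p) (hroot : ¬ P (root i j)) :
    ∃ a ∈ c, ∃ b ∈ c, GridAdj K M compat a b ∧ ¬ P a ∧ P b := by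
  obtain ⟨a, ha, b, hb, hab, h₁, h₂⟩ :=
    h.isDirectedCycle.exists_adj_of_mem (fun v => ¬ P v) h.mem hp hroot (not_not.2 hP)
  exact ⟨a, ha, b, hb, hab, h₁, not_not.1 h₂⟩

/-- Arcs between nodes never lead to a smaller row. So the rows beyond `j` can be left only towards
a root whose second index exceeds `j`, and such a root is not on the cycle. -/
theorem row_le (h : IsRootCycle K M compat i j c) {r t l : ℕ} (hp : node r t l ∈ c) : r ≤ j := by
  by_contra! hr
  obtain ⟨a, ha, b, hb, hab, ⟨r', t', l', rfl, hr'⟩, hPb⟩ :=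
    h.exists_leave (fun p => ∃ r t l, p = node r t l ∧ j < r) hp ⟨r, t, l, rfl, hr⟩ (by simp)
  generalize hp : node r' t' l' = p at hab
  have hle := h.le
  cases hab <;> simp at hp
  case finish => have := h.unique _ _ hb; omega
  case step => simp at hPb; omega
  case skip => simp at hPb; omega
  case down => simp at hPb; omega
  case cross => simp at hPb; omega
  case exit => have := h.unique _ _ hb; omega

/-- Dually, the rows before `i` can be entered only from a root whose first index is less than `i`.
-/
theorem le_row (h : IsRootCycle K M compat i j c) {r t l : ℕ} (hp : node r t l ∈ c) : i ≤ r := by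
  by_contra! hr
  obtain ⟨a, ha, b, hb, hab, hPa, ⟨r', t', l', rfl, hr'⟩⟩ :=
    h.exists_arrive (fun p => ∃ r t l, p = node r t l ∧ r < i) hp ⟨r, t, l, rfl, hr⟩ (by simp)
  generalize hp : node r' t' l' = p at hab
  have hle := h.le
  cases hab <;> simp at hp
  case start => have := h.unique _ _ ha; omega
  case step => simp at hPa; omega
  case skip => simp at hPa; omega
  case down => simp at hPa; omega
  case cross => simp at hPa; omega
  case enter => have := h.unique _ _ ha; omega

/-- The cycle of the root `(i, i)` stays on level `1` once it is there. -/
theorem upper (h : IsRootCycle K M compat i i c) {t : ℕ} (ht : node i t 1 ∈ c) {t' : ℕ}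
    (htt' : t ≤ t') (ht' : t' < M * K) : node i t' 1 ∈ c := by
  induction t', htt' using Nat.le_induction with
  | base => exact ht
  | succ t' _ ih =>
    -- Neither a higher row nor a foreign root is allowed, so the cycle has to go on to the next
    -- position.
    obtain ⟨q, hq, hpq⟩ := h.exists_succ (ih (by omega))
    generalize hp : node i t' 1 = p at hpq
    cases hpq <;> simp at hp
    case finish => omega
    case step => obtain ⟨rfl, rfl, rfl⟩ := hp; exact hq
    case cross => have := h.row_le hq; omega
    case exit => have := h.unique _ _ hq; omega

/-- The cycle of the root `(i, i)` is on level `0` before it leaves it. -/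
theorem lower (h : IsRootCycle K M compat i i c) {t : ℕ} (ht : node i t 0 ∈ c) {t' : ℕ}
    (ht' : t' ≤ t) : node i t' 0 ∈ c := by
  induction t with
  | zero => rwa [Nat.le_zero.1 ht']
  | succ t ih =>
    rcases Nat.lt_or_ge t t' with hlt | hge
    · rwa [show t' = t + 1 by omega]
    · refine ih ?_ hge
      obtain ⟨q, hq, hqp⟩ := h.exists_pred ht
      generalize hp : node i (t + 1) 0 = p at hqp
      cases hqp <;> simp at hp
      case step => obtain ⟨rfl, rfl, rfl⟩ := hp; exact hq
      case enter => have := h.unique _ _ hq; omega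
      case cross => have := h.le_row hq; omega

/-- The cycle of the root `(i, i)` misses positions of at most one block of its row. -/
theorem exists_block (h : IsRootCycle K M compat i i c) :
    ∃ v, ∀ t < M * K, t / K ≠ v → node i t 0 ∈ c ∨ node i t 1 ∈ c := by
  have hK : 0 < K := by have := h.lt; omega
  have h₀ : node i 0 0 ∈ c := by
    obtain ⟨q, hq, hpq⟩ := h.exists_succ h.mem
    generalize hp : root i i = p at hpq
    cases hpq <;> simp at hp
    case start => obtain ⟨rfl, -⟩ := hp; exact hq
    case enter => omega
    case toMate => omega
  -- Consider an arc by which the cycle leaves level `0`: everything up to its tail is used on level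
  -- `0`, and everything from its head on is used on level `1`.
  obtain ⟨a, ha, b, hb, hab, ⟨t, l, rfl, rfl⟩, hPb⟩ :=
    h.exists_leave (NodeWith i fun _ l => l = 0) h₀ ⟨0, 0, rfl, rfl⟩ (by simp [NodeWith])
  generalize hp : node i t 0 = p at hab
  cases hab <;> simp at hp
  case step => simp [NodeWith] at hPb; omega
  case skip w _ hw ht =>
    obtain ⟨rfl, rfl⟩ := hp
    -- The positions from `(w + 1) * K` to `(w + 2) * K - 1`, which are jumped over, form the block
    -- `w + 1`.
    refine ⟨w + 1, fun t' ht' hne => ?_⟩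
    rcases Nat.lt_or_ge t t' with hlt | hge
    · refine .inr (h.upper hb ?_ ht')
      by_contra! hlt'
      refine hne (Nat.div_eq_of_lt_le ?_ ?_) <;> grind
    · exact .inl (h.lower ha hge)
  case down =>
    obtain ⟨rfl, rfl⟩ := hp
    -- No position is missed in this case, so the block is arbitrary.
    refine ⟨0, fun t' ht' _ => ?_⟩
    rcases Nat.lt_or_ge t t' with hlt | hge
    · exact .inr (h.upper hb hlt.le ht')
    · exact .inl (h.lower ha hge)

/-- A verifier cycle that is disjoint from a selector cycle passes the row of the selector only in
the block that the selector skips. -/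
theorem div_eq_of_disjoint (h : IsRootCycle K M compat i j c) {r v : ℕ}
    {s : Cycle GridVertex} (hs : IsRootCycle K M compat r r s)
    (hv : ∀ t < M * K, t / K ≠ v → node r t 0 ∈ s ∨ node r t 1 ∈ s)
    (hd : ∀ p ∈ c, p ∉ s) {t l : ℕ} (ht : t < M * K) (hl : l < 2) (hp : node r t l ∈ c) :
    t / K = v := by
  by_contra hne
  have hcov := hv t ht hne
  have hl' : l = 0 ∨ l = 1 := by omega
  rcases hl' with rfl | rfl
  -- Here the selector uses position `t` on level `1`, and so all later positions of level `1`. The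
  -- other cycle could never descend from level `0`, but only level `1` leads out of the row.
  · have h₁ := hcov.resolve_left (hd _ hp)
    obtain ⟨a, ha, b, hb, hab, ⟨t', l', rfl, hle, htM, rfl⟩, hPb⟩ :=
      h.exists_leave (NodeWith r fun t' l => t ≤ t' ∧ t' < M * K ∧ l = 0) hp
        ⟨t, 0, rfl, le_rfl, ht, rfl⟩ (by simp [NodeWith])
    generalize hp : node r t' 0 = p at hab
    cases hab <;> simp at hp
    case step => simp [NodeWith] at hPb; omega
    case skip w _ hw ht' =>
      obtain ⟨rfl, rfl⟩ := hp
      have : (w + 2) * K = (w + 1) * K + K := by ring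
      have : (w + 2) * K < M * K := Nat.mul_lt_mul_of_pos_right hw (by have := h.lt; omega)
      exact hd _ hb (hs.upper h₁ (by omega) this)
    case down =>
      obtain ⟨rfl, rfl⟩ := hp
      exact hd _ hb (hs.upper h₁ hle htM)
  -- Symmetrically, the selector uses level `0` up to position `t`, and the other cycle could not
  -- have come down to level `1` at a position up to `t`.
  · have h₁ := hcov.resolve_right (hd _ hp)
    obtain ⟨a, ha, b, hb, hab, hPa, ⟨t', l', rfl, hle, rfl⟩⟩ :=
      h.exists_arrive (NodeWith r fun t' l => t' ≤ t ∧ l = 1) hp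
        ⟨t, 1, rfl, le_rfl, rfl⟩ (by simp [NodeWith])
    generalize hp : node r t' 1 = p at hab
    cases hab <;> simp at hp
    case step => simp [NodeWith] at hPa; omega
    case skip w _ hw ht =>
      obtain ⟨rfl, rfl⟩ := hp
      have : (w + 2) * K = (w + 1) * K + K := by ring
      exact hd _ ha (hs.lower h₁ (by omega))
    case down =>
      obtain ⟨rfl, rfl⟩ := hp
      exact hd _ ha (hs.lower h₁ hle)

/-- A verifier cycle witnesses that the selected values are compatible. -/
theorem compat_of_disjoint (h : IsRootCycle K M compat i j c) (hij : i < j) {x : ℕ → ℕ}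
    (hx : ∀ r t l, t < M * K → l < 2 → node r t l ∈ c → t / K = x r) :
    x i < M ∧ x j < M ∧ compat i (x i) j (x j) := by
  have hjK := h.lt
  have hdiv : ∀ u b, b < K → (u * K + b) / K = u := fun u b hb => by
    rw [Nat.mul_comm, Nat.mul_add_div (by omega), Nat.div_eq_of_lt hb, Nat.add_zero]
  obtain ⟨u, hu, hp⟩ : ∃ u < M, node i (u * K + j) 0 ∈ c := by
    obtain ⟨q, hq, hpq⟩ := h.exists_succ h.mem
    generalize hp : root i j = p at hpq
    cases hpq <;> simp at hp
    case start => omega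
    case enter u _ _ hu => obtain ⟨rfl, rfl⟩ := hp; exact ⟨u, hu, hq⟩
    case toMate => omega
  have hux := hx _ _ _ (mul_add_lt_mul hu h.lt) (by omega) hp
  rw [hdiv _ _ h.lt] at hux
  obtain ⟨a, ha, b, hb, hab, ⟨t, l, rfl, hle, htM⟩, hPb⟩ :=
    h.exists_leave (NodeWith i fun t _ => u * K + j ≤ t ∧ t < M * K) hp
      ⟨_, 0, rfl, le_rfl, mul_add_lt_mul hu h.lt⟩ (by simp [NodeWith])
  generalize hp : node i t l = p at hab
  cases hab <;> simp at hp
  case finish => have := h.unique _ _ hb; omega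
  case step => simp [NodeWith] at hPb; omega
  case skip w _ hw ht =>
    have : (w + 2) * K = (w + 1) * K + K := by ring
    have : (w + 2) * K < M * K := Nat.mul_lt_mul_of_pos_right hw (by omega)
    simp [NodeWith] at hPb
    omega
  case down => simp [NodeWith] at hPb; omega
  case cross j' u' v' hij' hj' hu' hv' hcompat =>
    obtain ⟨rfl, rfl, rfl⟩ := hp
    have hux' := hx _ _ _ htM (by omega) ha
    rw [hdiv _ _ hj'] at hux'
    -- Positions do not decrease within row `i`, and the points of entry and of departure lie in the
    -- same block `x i`, so `j ≤ j'`. The rows beyond `j` are forbidden, so `j' ≤ j`. This is why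
    -- the partner's index serves as the offset in the block.
    have hj : j' = j := by
      have := h.row_le hb
      have : u = u' := by omega
      subst this
      omega
    subst hj
    have hvx := hx _ _ _ (mul_add_lt_mul hv' (by omega)) (by omega) hb
    rw [hdiv _ _ (by omega)] at hvx
    rw [← hux', ← hvx]
    exact ⟨hu', hv', hcompat⟩
  case exit => have := h.unique _ _ hb; omega

end IsRootCycle

theorem exists_isSolution_of_hasDisjointCycles (h : (grid K M compat).HasDisjointCycles (K * K)) :
    ∃ x, IsSolution K M compat x := by
  obtain ⟨C, hC, huniq⟩ := exists_cycle_of_root h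
  have hroot : ∀ i j, i ≤ j → j < K → IsRootCycle K M compat i j (C i j) := by
    intro i j hij hj
    refine ⟨(hC i j (by omega) hj).1, (hC i j (by omega) hj).2, hij, hj, fun i' j' hmem => ?_⟩
    have hlt : i' < K ∧ j' < K := by
      obtain ⟨q, hq, hpq⟩ := (hC i j (by omega) hj).1.exists_succ hmem
      generalize hp : root i' j' = p at hpq
      cases hpq <;> simp at hp <;> omega
    exact huniq i' j' i j hlt.1 hlt.2 (by omega) hj _ (hC i' j' hlt.1 hlt.2).2 hmem
  choose! x hx using fun i (hi : i < K) => (hroot i i le_rfl hi).exists_block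
  refine ⟨x, fun i j hij hj => (hroot i j hij.le hj).compat_of_disjoint hij ?_⟩
  intro r t l ht hl hp
  have hr : r < K := ((hroot i j hij.le hj).row_le hp).trans_lt hj
  refine (hroot i j hij.le hj).div_eq_of_disjoint (hroot r r le_rfl hr) (hx r hr) ?_ ht hl hp
  intro p hp hp'
  have := huniq i j r r (by omega) hj hr hr p hp hp'
  omega

/-! ### The cycles of a solution -/

/-- The vertices of the selector cycle of row `i` for the value `v`, in their order. -/
def selector (K i v : ℕ) : ℕ → GridVertex
  | 0 => root i i
  | s + 1 => if s < v * K then node i s 0 else node i (s + K) 1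

/-- The cycle of the solution `x` with the root `(i, j)`. -/
def solutionCycle (K M : ℕ) (x : ℕ → ℕ) (i j : ℕ) : Cycle GridVertex :=
  if i = j then ((List.range (M * K - K).succ).map (selector K i (x i)) : List GridVertex)
  else if i < j then
    ([root i j, node i (x i * K + j) 0, node i (x i * K + j) 1, node j (x j * K + i) 0,
      node j (x j * K + i) 1] : List GridVertex)
  else ([root i j, mate i j] : List GridVertex)

/-- A `skip` needs a block before and a block after the one that it omits. Hence the first and the
last value cannot be selected. -/
theorem isDirectedCycle_selector {i v : ℕ} (hi : i < K) (hv₀ : 0 < v) (hv : v + 1 < M) :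
    (grid K M compat).IsDirectedCycle
      ((List.range (M * K - K).succ).map (selector K i v) : List GridVertex) := by
  obtain ⟨w, rfl⟩ : ∃ w, v = w + 1 := ⟨v - 1, by omega⟩
  have hMK : (w + 2) * K < M * K := Nat.mul_lt_mul_of_pos_right (by omega) (by omega)
  have h₁ : (w + 2) * K = (w + 1) * K + K := by ring
  have h₂ : 0 < (w + 1) * K := Nat.mul_pos (by omega) (by omega)
  refine ⟨by simp, ?_, ?_⟩
  · rw [Cycle.nodup_coe_iff]
    refine List.Nodup.map_on ?_ List.nodup_range
    rintro (- | a) - (- | b) - hab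
    · rfl
    · simp only [selector] at hab; split_ifs at hab
    · simp only [selector] at hab; split_ifs at hab
    · simp only [selector] at hab
      split_ifs at hab <;> simp at hab <;> omega
  · rw [← Cycle.map_coe, Cycle.chain_map, Cycle.chain_range_succ]
    obtain ⟨n, hn⟩ : ∃ n, M * K - K = n + 1 := ⟨M * K - K - 1, by omega⟩
    constructor
    · rw [hn]
      simp only [selector]
      rw [if_neg (by omega)]
      exact .finish hi (by omega)
    · rintro (- | m) hm
      · simp only [selector]
        rw [if_pos (by omega)]
        exact .start hi
      · simp only [selector]
        split_ifs with h₃ h₄ h₄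
        · exact .step hi (by omega) (by omega)
        · have : m + 1 = (w + 1) * K := by omega
          rw [this, ← h₁]
          exact .skip hi (by omega) this
        · omega
        · rw [Nat.add_right_comm]
          exact .step hi (by omega) (by omega)

/-- The root of the cycle of the solution `x` that a vertex may belong to. -/
def owner (K : ℕ) (x : ℕ → ℕ) : GridVertex → ℕ × ℕ
  | root i j => (i, j)
  | mate i j => (i, j)
  | node r t _ => if t / K = x r then
      (if r < t % K then (r, t % K) else (t % K, r)) else (r, r)

/-- This yields disjointness, since the root can be recovered from any vertex of its cycle. In the
selected block of a row, the offset names the other row of the verifier; the rest of the row belongs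
to the selector. -/
theorem owner_eq_of_mem {x : ℕ → ℕ} {i j : ℕ} (hi : i < K) (hj : j < K) {p : GridVertex}
    (hp : p ∈ solutionCycle K M x i j) : owner K x p = (i, j) := by
  have hdiv : ∀ u b, b < K → (u * K + b) / K = u := fun u b hb => by
    rw [Nat.mul_comm, Nat.mul_add_div (by omega), Nat.div_eq_of_lt hb, Nat.add_zero]
  have hmod : ∀ u b, b < K → (u * K + b) % K = b := fun u b hb => by
    rw [Nat.mul_comm, Nat.mul_add_mod, Nat.mod_eq_of_lt hb]
  unfold solutionCycle at hp
  split_ifs at hp with h₁ h₂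
  · subst h₁
    rw [Cycle.mem_coe_iff, List.mem_map] at hp
    obtain ⟨- | s, hs, rfl⟩ := hp
    · rfl
    · simp only [selector]
      split_ifs with h
      · simp only [owner]
        rw [if_neg]
        have := (Nat.div_lt_iff_lt_mul (by omega)).2 h
        omega
      · simp only [owner]
        rw [if_neg]
        have : x i + 1 ≤ (s + K) / K := by
          rw [Nat.le_div_iff_mul_le (by omega), Nat.add_mul]
          omega
        omega
  · simp only [Cycle.mem_coe_iff, List.mem_cons, List.not_mem_nil, or_false] at hp
    rcases hp with rfl | rfl | rfl | rfl | rfl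
    · rfl
    all_goals simp only [owner, hdiv _ _ hi, hdiv _ _ hj, hmod _ _ hi, hmod _ _ hj, if_true]
    all_goals split_ifs <;> first | rfl | omega
  · simp only [Cycle.mem_coe_iff, List.mem_cons, List.not_mem_nil, or_false] at hp
    rcases hp with rfl | rfl <;> rfl

theorem IsSolution.hasDisjointCycles {x : ℕ → ℕ} (hx : IsSolution K M compat x)
    (hx₀ : ∀ i < K, 0 < x i) (hxM : ∀ i < K, x i + 1 < M) :
    (grid K M compat).HasDisjointCycles (K * K) := by
  have hC : ∀ i j, i < K → j < K →
      (grid K M compat).IsDirectedCycle (solutionCycle K M x i j) := by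
    intro i j hi hj
    unfold solutionCycle
    split_ifs with h₁ h₂
    · exact isDirectedCycle_selector hi (hx₀ i hi) (hxM i hi)
    · obtain ⟨hxi, hxj, hcompat⟩ := hx i j h₂ hj
      refine ⟨by simp, ?_, ?_⟩
      · simp [h₁]
      · simp only [Cycle.chain_coe_cons, List.cons_append, List.nil_append,
          List.isChain_cons_cons, List.isChain_singleton, and_true]
        exact ⟨.enter h₂ hj hxi, .down hi (mul_add_lt_mul hxi hj), .cross h₂ hj hxi hxj hcompat,
          .down hj (mul_add_lt_mul hxj hi), .exit h₂ hj hxj⟩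
    · refine ⟨by simp, by simp, ?_⟩
      simp only [Cycle.chain_coe_cons, List.cons_append, List.nil_append,
          List.isChain_cons_cons, List.isChain_singleton, and_true]
      exact ⟨.toMate (by omega) hi, .ofMate (by omega) hi⟩
  refine ⟨fun a => solutionCycle K M x (finProdFinEquiv.symm a).1 (finProdFinEquiv.symm a).2,
    fun a => hC _ _ (Fin.is_lt _) (Fin.is_lt _), fun a b hab p hp hp' => hab ?_⟩
  have h₁ := owner_eq_of_mem (Fin.is_lt _) (Fin.is_lt _) hp
  rw [owner_eq_of_mem (Fin.is_lt _) (Fin.is_lt _) hp', Prod.mk.injEq] at h₁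
  exact finProdFinEquiv.symm.injective
    (Prod.ext (Fin.val_injective h₁.1.symm) (Fin.val_injective h₁.2.symm))

end Digraph

namespace ParamComplexity

/-! ## Weighted 2-CNF satisfiability as a constraint satisfaction problem -/

/-- The literal with the variable `w` and the sign `s` is falsified by an assignment for which `a`
and `b` are consecutive true variables (where the variables are numbered from `1`). -/
def FalsifiedBy (a b w s : ℕ) : Prop :=
  (s = 0 ∧ a < w + 1 ∧ w + 1 < b) ∨ (s = 1 ∧ w + 1 = a)

/-- The pairs `(a, b)` and `(c, d)` with the codes `u` and `v` can be the `i`-th and the `j`-th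
pair of consecutive true variables in an assignment of weight `k` that respects the clauses; `0`
and `n + 1` count as true variables. The clauses are given by the set `cl` of their positions in a
square matrix. -/
def GapCompat (n k : ℕ) (cl : ℕ → Prop) (i u j v : ℕ) : Prop :=
  ∃ a < n + 3, ∃ b < n + 3, ∃ c < n + 3, ∃ d < n + 3,
    u = a * (n + 3) + b ∧ v = c * (n + 3) + d ∧ a < b ∧ c < d ∧ (i = 0 → a = 0) ∧
    (j = k + 1 → c = n + 1) ∧ (j = i + 1 → b = c) ∧
    ∀ w < n, ∀ s < 2, ∀ w' < n, ∀ s' < 2, cl ((w * 2 + s) * (n * 2) + (w' * 2 + s')) →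
      ¬ ((FalsifiedBy a b w s ∨ FalsifiedBy c d w s) ∧
        (FalsifiedBy a b w' s' ∨ FalsifiedBy c d w' s'))

/-- The assignment `a` respects the clauses at the positions in `cl`. -/
def Respects {n : ℕ} (cl : ℕ → Prop) (a : Fin n → Bool) : Prop :=
  ∀ l l' : Literal n,
    cl ((l.1 * 2 + l.2) * (n * 2) + (l'.1 * 2 + l'.2)) → l.Holds a ∨ l'.Holds a

/-! ### Assignments of weight `k` and their gaps -/

variable {n k : ℕ} {cl : ℕ → Prop}

/-- The two values that no selector can skip are the codes of `(0, 0)` and `(n + 2, n + 2)`, which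
are not gaps. -/
theorem code_bounds {a b n : ℕ} (hab : a < b) (hb : b < n + 3) :
    0 < a * (n + 3) + b ∧ a * (n + 3) + b + 1 < (n + 3) * (n + 3) := by
  refine ⟨by omega, ?_⟩
  have : (a + 1) * (n + 3) ≤ (n + 2) * (n + 3) := Nat.mul_le_mul_right _ (by omega)
  nlinarith

theorem isSolution_bounds {x : ℕ → ℕ} {M : ℕ} (hM : M = (n + 3) * (n + 3))
    (hx : Digraph.IsSolution (k + 2) M (GapCompat n k cl) x) :
    ∀ i < k + 2, 0 < x i ∧ x i + 1 < M := by
  intro i hi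
  subst hM
  rcases Nat.lt_or_ge i (k + 1) with h | h
  · obtain ⟨-, -, a, -, b, hb, c, -, d, hd, hu, hv, hab, hcd, -⟩ := hx i (k + 1) h (by omega)
    rw [hu]
    exact code_bounds hab hb
  · obtain ⟨-, -, a, -, b, hb, c, -, d, hd, hu, hv, hab, hcd, -⟩ := hx 0 i (by omega) hi
    rw [hv]
    exact code_bounds hcd hd

/-- The true variables of an assignment, numbered from `1`, and the values that count as such. -/
def IsMark (a : Fin n → Bool) (m : ℕ) : Prop :=
  m = 0 ∨ n < m ∨ ∃ w : Fin n, m = w + 1 ∧ a w = true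

theorem isMark_infinite (a : Fin n → Bool) : {m | IsMark a m}.Infinite :=
  Set.infinite_of_not_bddAbove fun ⟨B, hB⟩ => by
    have : B + n + 1 ≤ B := hB (show IsMark a (B + n + 1) from .inr (.inl (by omega)))
    omega

open Classical in
-- Below `n + 1` the marks are `0` and the `k` true variables, so `n + 1` is the mark with the index
-- `k + 1`.
theorem nth_isMark {a : Fin n → Bool}
    (ha : (Finset.univ.filter fun v => a v = true).card = k) :
    Nat.nth (IsMark a) 0 = 0 ∧ Nat.nth (IsMark a) (k + 1) = n + 1 ∧
      Nat.nth (IsMark a) (k + 2) = n + 2 := by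
  have h₁ : Nat.count (IsMark a) (n + 1) = k + 1 := by
    rw [Nat.count_eq_card_filter_range]
    have : (Finset.range (n + 1)).filter (IsMark a) =
        insert 0 ((Finset.univ.filter fun v => a v = true).image fun w : Fin n => (w : ℕ) + 1) := by
      ext m
      simp only [IsMark, Finset.mem_filter, Finset.mem_range, Finset.mem_insert, Finset.mem_image,
        Finset.mem_univ, true_and]
      constructor
      · rintro ⟨hm, h | h | ⟨w, h, hw⟩⟩
        · exact .inl h
        · omega
        · exact .inr ⟨w, hw, h.symm⟩
      · rintro (h | ⟨w, hw, h⟩)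
        · exact ⟨by omega, .inl h⟩
        · exact ⟨by omega, .inr (.inr ⟨w, h.symm, hw⟩)⟩
    rw [this, Finset.card_insert_of_notMem (by simp), Finset.card_image_of_injective, ha]
    exact fun v w h => Fin.ext (by simpa using h)
  have hm : ∀ m, n < m → IsMark a m := fun m hm => .inr (.inl hm)
  have h₂ : Nat.count (IsMark a) (n + 2) = k + 2 := by
    rw [Nat.count_succ, h₁, if_pos (hm _ (by omega))]
  refine ⟨?_, ?_, ?_⟩
  · have := Nat.nth_count (p := IsMark a) (n := 0) (.inl rfl)
    simpa using this
  · rw [← h₁]; exact Nat.nth_count (hm _ (by omega))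
  · rw [← h₂]; exact Nat.nth_count (hm _ (by omega))

theorem exists_isSolution {a : Fin n → Bool} (hcl : Respects cl a)
    (ha : (Finset.univ.filter fun v => a v = true).card = k) :
    ∃ x, Digraph.IsSolution (k + 2) ((n + 3) * (n + 3)) (GapCompat n k cl) x := by
  classical
  obtain ⟨h₀, h₁, h₂⟩ := nth_isMark ha
  set s := Nat.nth (IsMark a) with hs
  have hmono : StrictMono s := Nat.nth_strictMono (isMark_infinite a)
  have hmark : ∀ i, IsMark a (s i) := Nat.nth_mem_of_infinite (isMark_infinite a)
  have hbd : ∀ i ≤ k + 2, s i < n + 3 := fun i hi => by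
    have := hmono.monotone hi
    omega
  have hM : ∀ i < k + 2, s i * (n + 3) + s (i + 1) < (n + 3) * (n + 3) := fun i hi => by
    have := (code_bounds (hmono (show i < i + 1 by omega)) (hbd (i + 1) hi)).2
    omega
  have hfals : ∀ i (w : Fin n) (e : Fin 2), FalsifiedBy (s i) (s (i + 1)) w e →
      ¬ Literal.Holds a (w, e) := by
    rintro i w e (⟨he, hlt, hgt⟩ | ⟨he, hw⟩)
    · have he : e = 0 := Fin.ext he
      subst he
      simp only [Literal.Holds, if_true]
      intro haw
      -- A true variable is itself a mark, so it cannot lie strictly between two consecutive marks.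
      have hm : s (Nat.count (IsMark a) (w + 1)) = w + 1 := Nat.nth_count (.inr (.inr ⟨w, rfl, haw⟩))
      rw [← hm] at hlt hgt
      have := hmono.lt_iff_lt.1 hlt
      have := hmono.lt_iff_lt.1 hgt
      omega
    · have he : e = 1 := Fin.ext he
      subst he
      have := hmark i
      rw [← hw] at this
      rcases this with h | h | ⟨w', h, haw⟩
      · omega
      · omega
      · have : w = w' := Fin.ext (by omega)
        subst this
        simp [Literal.Holds, haw]
  refine ⟨fun i => s i * (n + 3) + s (i + 1), fun i j hij hj => ⟨hM i (by omega), hM j hj, s i,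
    hbd _ (by omega), s (i + 1), hbd _ (by omega), s j, hbd _ (by omega), s (j + 1),
    hbd _ (by omega), rfl, rfl, hmono (Nat.lt_succ_self _), hmono (Nat.lt_succ_self _), ?_, ?_, ?_,
    ?_⟩⟩
  · rintro rfl; exact h₀
  · rintro rfl; exact h₁
  · rintro rfl; rfl
  · intro w hw e he w' hw' e' he' hc ⟨h, h'⟩
    rcases hcl (⟨w, hw⟩, ⟨e, he⟩) (⟨w', hw'⟩, ⟨e', he'⟩) hc with hh | hh
    · exact h.elim (fun h => hfals i ⟨w, hw⟩ ⟨e, he⟩ h hh) fun h => hfals j ⟨w, hw⟩ ⟨e, he⟩ h hh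
    · exact h'.elim (fun h => hfals i ⟨w', hw'⟩ ⟨e', he'⟩ h hh)
        fun h => hfals j ⟨w', hw'⟩ ⟨e', he'⟩ h hh

/-- The constraints on neighbouring indices glue the pairs to a strictly increasing sequence from
`0` to `n + 1`. Its `k` inner members are the true variables. -/
theorem exists_assignment {x : ℕ → ℕ}
    (hx : Digraph.IsSolution (k + 2) ((n + 3) * (n + 3)) (GapCompat n k cl) x) :
    ∃ a : Fin n → Bool, Respects cl a ∧
      (Finset.univ.filter fun v => a v = true).card = k := by
  obtain ⟨s, t, hst, h₀, h₁, hsucc, hcl⟩ : ∃ s t : ℕ → ℕ, (∀ i < k + 2, s i < t i) ∧ s 0 = 0 ∧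
      s (k + 1) = n + 1 ∧ (∀ i, i + 1 < k + 2 → t i = s (i + 1)) ∧
      ∀ i j, i < j → j < k + 2 →
      ∀ w < n, ∀ e < 2, ∀ w' < n, ∀ e' < 2, cl ((w * 2 + e) * (n * 2) + (w' * 2 + e')) →
      ¬ ((FalsifiedBy (s i) (t i) w e ∨ FalsifiedBy (s j) (t j) w e) ∧
        (FalsifiedBy (s i) (t i) w' e' ∨ FalsifiedBy (s j) (t j) w' e')) := by
    have hdiv : ∀ a b, b < n + 3 → (a * (n + 3) + b) / (n + 3) = a := fun a b hb => by
      rw [Nat.mul_comm, Nat.mul_add_div (by omega), Nat.div_eq_of_lt hb, Nat.add_zero]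
    have hmod : ∀ a b, b < n + 3 → (a * (n + 3) + b) % (n + 3) = b := fun a b hb => by
      rw [Nat.mul_comm, Nat.mul_add_mod, Nat.mod_eq_of_lt hb]
    have key : ∀ i j, i < j → j < k + 2 → (x i / (n + 3) < x i % (n + 3)) ∧
        (x j / (n + 3) < x j % (n + 3)) ∧ (i = 0 → x i / (n + 3) = 0) ∧
        (j = k + 1 → x j / (n + 3) = n + 1) ∧ (j = i + 1 → x i % (n + 3) = x j / (n + 3)) ∧
        ∀ w < n, ∀ e < 2, ∀ w' < n, ∀ e' < 2, cl ((w * 2 + e) * (n * 2) + (w' * 2 + e')) →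
        ¬ ((FalsifiedBy (x i / (n + 3)) (x i % (n + 3)) w e ∨
            FalsifiedBy (x j / (n + 3)) (x j % (n + 3)) w e) ∧
          (FalsifiedBy (x i / (n + 3)) (x i % (n + 3)) w' e' ∨
            FalsifiedBy (x j / (n + 3)) (x j % (n + 3)) w' e')) := by
      intro i j hij hj
      obtain ⟨-, -, a, -, b, hb, c, -, d, hd, hu, hv, h⟩ := hx i j hij hj
      rw [hu, hv, hdiv a b hb, hdiv c d hd, hmod a b hb, hmod c d hd]
      exact h
    refine ⟨fun i => x i / (n + 3), fun i => x i % (n + 3), fun i hi => ?_,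
      (key 0 1 (by omega) (by omega)).2.2.1 rfl, (key 0 (k + 1) (by omega) (by omega)).2.2.2.1 rfl,
      fun i hi => (key i (i + 1) (by omega) hi).2.2.2.2.1 rfl,
      fun i j hij hj => (key i j hij hj).2.2.2.2.2⟩
    rcases Nat.lt_or_ge i (k + 1) with h | h
    · exact (key i (k + 1) h (by omega)).1
    · exact (key 0 i (by omega) hi).2.1
  have hmono : ∀ i j, i < j → j < k + 2 → s i < s j := by
    intro i j hij
    induction j, hij using Nat.le_induction with
    | base =>
      intro h
      rw [← hsucc i h]
      exact hst i (by omega)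
    | succ j hij ih =>
      intro h
      have := hst j (by omega)
      rw [hsucc j h] at this
      exact (ih (by omega)).trans this
  have hinj : ∀ i j, i < k + 2 → j < k + 2 → s i = s j → i = j := by
    intro i j hi hj h
    rcases Nat.lt_trichotomy i j with hlt | heq | hgt
    · have := hmono i j hlt hj; omega
    · exact heq
    · have := hmono j i hgt hi; omega
  classical
  let a : Fin n → Bool := fun w => decide (∃ i < k + 2, s i = w + 1)
  have hfals : ∀ l : Literal n, ¬ l.Holds a → ∃ i < k + 2, FalsifiedBy (s i) (t i) l.1 l.2 := by
    rintro ⟨w, e⟩ h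
    fin_cases e
    · simp only [Literal.Holds, Fin.zero_eta, if_true, a, decide_eq_true_eq] at h
      push Not at h
      -- The gap around a false variable ends at the first `s i` beyond it. This is not `s 0 = 0`,
      -- and it exists because `s (k + 1) = n + 1`.
      have hex : ∃ i, w + 1 < s i ∧ i < k + 2 := ⟨k + 1, by omega, by omega⟩
      obtain ⟨hlt, hfi⟩ := Nat.find_spec hex
      rcases hf : Nat.find hex with - | i
      · rw [hf] at hlt; omega
      · rw [hf] at hlt hfi
        have hmin := Nat.find_min hex (m := i) (by omega)
        have hne := h i (by omega)
        refine ⟨i, by omega, .inl ⟨rfl, ?_, ?_⟩⟩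
        · by_contra hge
          exact hmin ⟨by dsimp only at hge ⊢; omega, by omega⟩
        · rw [hsucc i hfi]; exact hlt
    · simp only [Literal.Holds, a] at h
      simp at h
      obtain ⟨i, hi, h⟩ := h
      exact ⟨i, hi, .inr ⟨rfl, h.symm⟩⟩
  refine ⟨a, fun l l' hc => ?_, ?_⟩
  · by_contra hno
    rw [not_or] at hno
    obtain ⟨i, hi, h⟩ := hfals l hno.1
    obtain ⟨i', hi', h'⟩ := hfals l' hno.2
    have hcl' : ∀ p q, p < q → q < k + 2 → (i = p ∨ i = q) → (i' = p ∨ i' = q) → False := by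
      intro p q hpq hq h₁ h₂
      refine hcl p q hpq hq l.1 l.1.2 l.2 l.2.2 l'.1 l'.1.2 l'.2 l'.2.2 hc ⟨?_, ?_⟩
      · rcases h₁ with rfl | rfl
        · exact .inl h
        · exact .inr h
      · rcases h₂ with rfl | rfl
        · exact .inl h'
        · exact .inr h'
    rcases Nat.lt_trichotomy i i' with hlt | heq | hgt
    · exact hcl' i i' hlt hi' (by omega) (by omega)
    -- If a single gap falsifies both literals, any other gap can serve as its partner; there are at
    -- least two gaps.
    · rcases Nat.lt_or_ge i (k + 1) with hlt | hge
      · exact hcl' i (k + 1) hlt (by omega) (by omega) (by omega)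
      · exact hcl' 0 i (by omega) hi (by omega) (by omega)
    · exact hcl' i' i hgt hi (by omega) (by omega)
  · have himg : ((Finset.univ.filter fun v => a v = true).image fun w : Fin n => (w : ℕ) + 1) =
        (Finset.Ico 1 (k + 1)).image s := by
      ext m
      simp only [Finset.mem_image, Finset.mem_filter, Finset.mem_univ, true_and, Finset.mem_Ico,
        a, decide_eq_true_eq]
      constructor
      · rintro ⟨w, ⟨i, hi, hw⟩, rfl⟩
        refine ⟨i, ⟨?_, ?_⟩, hw⟩
        · rcases i with - | i
          · omega
          · omega
        · by_contra hge
          have : i = k + 1 := by omega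
          subst this
          omega
      · rintro ⟨i, ⟨hi, hi'⟩, rfl⟩
        have h₂ := hmono 0 i (by omega) (by omega)
        have h₃ := hmono i (k + 1) (by omega) (by omega)
        exact ⟨⟨s i - 1, by omega⟩, ⟨i, by omega, by simp only; omega⟩, by simp only; omega⟩
    have hcard := congrArg Finset.card himg
    rw [Finset.card_image_of_injective, Finset.card_image_of_injOn] at hcard
    · simpa using hcard
    · intro i hi j hj h
      simp at hi hj
      exact hinj i j (by omega) (by omega) h
    · exact fun v w h => Fin.ext (by simpa using h)

/-! ## Matrices as strings -/

theorem length_encodeMatrix {m : ℕ} (A : Fin m → Fin m → Bool) :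
    (encodeMatrix A).length = m * m := by simp [encodeMatrix]

theorem getElem?_encodeMatrix {m : ℕ} (A : Fin m → Fin m → Bool) (i j : Fin m) :
    (encodeMatrix A)[(i : ℕ) * m + j]? = some (A i j) := by
  have hlt : (i : ℕ) * m + j < m * m := Digraph.mul_add_lt_mul i.2 j.2
  have e : (⟨(i : ℕ) * m + j, hlt⟩ : Fin (m * m)) = finProdFinEquiv (i, j) :=
    Fin.ext (by simp [finProdFinEquiv]; ring)
  rw [encodeMatrix, List.getElem?_ofFn, dif_pos hlt, e, Equiv.symm_apply_apply]

theorem encodeMatrix_injective {m : ℕ} {A A' : Fin m → Fin m → Bool}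
    (h : encodeMatrix A = encodeMatrix A') : A = A' := by
  funext i j
  have := getElem?_encodeMatrix A i j
  rw [h, getElem?_encodeMatrix] at this
  simpa using this.symm

theorem eq_encodeMatrix {m : ℕ} {y : List Bool} (hy : y.length = m * m)
    (A : Fin m → Fin m → Bool)
    (hA : ∀ i j : Fin m, y[(i : ℕ) * m + j]? = some (A i j)) : y = encodeMatrix A := by
  apply List.ext_getElem?
  intro p
  rcases Nat.lt_or_ge p (m * m) with hp | hp
  · have hm : 0 < m := Nat.pos_of_ne_zero (by rintro rfl; simp at hp)
    have hi : p / m < m := Nat.div_lt_of_lt_mul hp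
    have hj : p % m < m := Nat.mod_lt _ hm
    have e : p = (⟨p / m, hi⟩ : Fin m) * m + (⟨p % m, hj⟩ : Fin m) := by
      simp [Nat.div_add_mod']
    rw [e, hA, getElem?_encodeMatrix]
  · rw [List.getElem?_eq_none (by omega), List.getElem?_eq_none (by rw [length_encodeMatrix]; omega)]

/-- The clauses of the formula that is encoded by a string. -/
def IsClauseAt (y : List Bool) (p : ℕ) : Prop := y[p]? = some true

/-- Every string of length `(2n)²` encodes a formula, so well-formedness is a condition on the
length alone. -/
theorem mem_weightedTwoCNFSat_iff {y : List Bool} :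
    (y, k) ∈ weightedTwoCNFSat ↔ ∃ n, n * 2 * (n * 2) = y.length ∧
      ∃ a : Fin n → Bool, Respects (IsClauseAt y) a ∧
        (Finset.univ.filter fun v => a v = true).card = k := by
  have hcode : ∀ {n : ℕ} (l : Literal n), ((finProdFinEquiv l : Fin (n * 2)) : ℕ) = l.1 * 2 + l.2 :=
    fun l => by simp [finProdFinEquiv]; ring
  have key : ∀ {n : ℕ} (φ : TwoCNF n), y = φ.encode →
      ∀ a, φ.SatisfiedBy a ↔ Respects (IsClauseAt y) a := by
    rintro n φ rfl a
    have : ∀ l l' : Literal n, IsClauseAt φ.encode ((l.1 * 2 + l.2) * (n * 2) + (l'.1 * 2 + l'.2)) ↔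
        (l, l') ∈ φ := by
      intro l l'
      rw [IsClauseAt, ← hcode, ← hcode, TwoCNF.encode, getElem?_encodeMatrix]
      simp
    simp only [Respects, this]
    exact ⟨fun h l l' hc => h (l, l') hc, fun h c hc => h c.1 c.2 hc⟩
  constructor
  · rintro ⟨n, φ, hy, a, ha, hk⟩
    refine ⟨n, ?_, a, (key φ hy a).1 ha, hk⟩
    change y = _ at hy
    rw [hy, TwoCNF.encode, length_encodeMatrix]
  · rintro ⟨n, hy, a, ha, hk⟩
    classical
    let φ : TwoCNF n := Finset.univ.filter fun c =>
      IsClauseAt y ((c.1.1 * 2 + c.1.2) * (n * 2) + (c.2.1 * 2 + c.2.2))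
    have hφ : y = φ.encode := by
      refine eq_encodeMatrix hy.symm _ fun i j => ?_
      have hlt : (i : ℕ) * (n * 2) + j < y.length := by
        rw [← hy]; exact Digraph.mul_add_lt_mul i.2 j.2
      obtain ⟨l, rfl⟩ := finProdFinEquiv.surjective i
      obtain ⟨l', rfl⟩ := finProdFinEquiv.surjective j
      rw [Equiv.symm_apply_apply, Equiv.symm_apply_apply, List.getElem?_eq_getElem hlt]
      simp only [φ, Finset.mem_filter, Finset.mem_univ, true_and, IsClauseAt, ← hcode,
        List.getElem?_eq_getElem hlt]
      simp
    exact ⟨n, φ, hφ, a, (key φ hφ a).2 ha, hk⟩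

/-- The number of variables of a formula that is encoded by a string of length `L`. -/
def numVars (L : ℕ) : ℕ := ∑ m ∈ Finset.range (L + 1), if m * 2 * (m * 2) = L then m else 0

theorem numVars_eq {n L : ℕ} (h : n * 2 * (n * 2) = L) : numVars L = n := by
  rw [numVars, Finset.sum_eq_single n]
  · rw [if_pos h]
  · intro m _ hm
    rw [if_neg]
    intro hm'
    rw [← h] at hm'
    have := Nat.mul_self_inj.1 hm'
    omega
  · intro hn
    have : n ≤ L := by nlinarith
    simp at hn
    omega

/-- The constraints of the instance `(y, k)`. -/
def InstanceCompat (y : List Bool) (k i u j v : ℕ) : Prop :=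
  numVars y.length * 2 * (numVars y.length * 2) = y.length ∧
    GapCompat (numVars y.length) k (IsClauseAt y) i u j v

/-- The size of the domains for strings of length `L`. -/
def domainSize (L : ℕ) : ℕ := (numVars L + 3) * (numVars L + 3)

theorem mem_weightedTwoCNFSat_iff_hasDisjointCycles {y : List Bool} :
    (y, k) ∈ weightedTwoCNFSat ↔ (Digraph.grid (k + 2) (domainSize y.length)
      (InstanceCompat y k)).HasDisjointCycles ((k + 2) * (k + 2)) := by
  rw [mem_weightedTwoCNFSat_iff]
  constructor
  · rintro ⟨n, hn, a, ha, hk⟩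
    obtain rfl := numVars_eq hn
    obtain ⟨x, hx⟩ := exists_isSolution ha hk
    have hb := isSolution_bounds rfl hx
    refine Digraph.IsSolution.hasDisjointCycles (x := x) (fun i j hij hj => ?_)
      (fun i hi => (hb i hi).1) fun i hi => (hb i hi).2
    obtain ⟨h₁, h₂, h₃⟩ := hx i j hij hj
    exact ⟨h₁, h₂, hn, h₃⟩
  · intro h
    obtain ⟨x, hx⟩ := Digraph.exists_isSolution_of_hasDisjointCycles h
    -- The constraint between rows `0` and `1` is always present and includes the test of the
    -- length, so malformed strings become no-instances.
    have hn := (hx 0 1 (by omega) (by omega)).2.2.1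
    refine ⟨_, hn, exists_assignment (x := x) fun i j hij hj => ?_⟩
    obtain ⟨h₁, h₂, -, h₃⟩ := hx i j hij hj
    exact ⟨h₁, h₂, h₃⟩

end ParamComplexity

namespace Digraph

/-! ## Numbering the vertices -/

/-- The arcs of the Eulerian extension of the digraph with the arc relation `arc` on `0, …, N - 1`,
with its vertices numbered. -/
def EulerArc (N : ℕ) (arc : ℕ → ℕ → Prop) (x y : ℕ) : Prop :=
  ∃ u < N, ∃ v < N,
    ((x = u ∧ y = v) ∧ arc u v) ∨
    ((x = v ∧ y = N + (u * N + v)) ∧ (u = v ∨ arc u v)) ∨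
    (x = N + (u * N + v) ∧ y = N + (N * N + N * N)) ∨
    ((x = N + (N * N + N * N) ∧ y = N + (u * N + v)) ∧ ¬ (u = v ∨ arc u v)) ∨
    (x = N + (N * N + N * N) ∧ y = N + (N * N + (u * N + v))) ∨
    ((x = N + (N * N + (u * N + v)) ∧ y = u) ∧ (u = v ∨ arc u v)) ∨
    ((x = N + (N * N + (u * N + v)) ∧ y = N + (N * N + N * N)) ∧ ¬ (u = v ∨ arc u v)) ∨
    (x = N + (N * N + N * N) ∧ y = N + (N * N + N * N) + 1) ∨
    (x = N + (N * N + N * N) + 1 ∧ y = N + (N * N + N * N))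

/-- The number of vertices of the Eulerian extension. -/
abbrev eulerSize (N : ℕ) : ℕ := N + (N * N + (N * N + 2))

/-- The numbering of the vertices of the Eulerian extension. -/
def eulerEquiv (N : ℕ) : EulerVertex (Fin N) ≃ Fin (eulerSize N) :=
  (Equiv.sumCongr (Equiv.refl _) ((Equiv.sumCongr finProdFinEquiv
    ((Equiv.sumCongr finProdFinEquiv (Equiv.refl _)).trans finSumFinEquiv)).trans
      finSumFinEquiv)).trans finSumFinEquiv

open EulerVertex

section

variable {N : ℕ}

theorem eulerEquiv_base (v : Fin N) : (eulerEquiv N (base v) : ℕ) = v := by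
  simp [eulerEquiv]

theorem eulerEquiv_toHub (u v : Fin N) : (eulerEquiv N (toHub u v) : ℕ) = N + (u * N + v) := by
  simp [eulerEquiv, finProdFinEquiv]; ring

theorem eulerEquiv_fromHub (u v : Fin N) :
    (eulerEquiv N (fromHub u v) : ℕ) = N + (N * N + (u * N + v)) := by
  simp [eulerEquiv, finProdFinEquiv]; ring

theorem eulerEquiv_hub : (eulerEquiv N hub : ℕ) = N + (N * N + N * N) := by
  simp [eulerEquiv]

theorem eulerEquiv_spare : (eulerEquiv N spare : ℕ) = N + (N * N + N * N) + 1 := by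
  simp [eulerEquiv]; ring

/-- The two arcs at the spare vertex also stand under the quantifiers over `u` and `v`, which need a
value; hence `0 < N`. -/
theorem eulerArc_iff (hN : 0 < N) (arc : ℕ → ℕ → Prop) (a b : EulerVertex (Fin N)) :
    EulerArc N arc (eulerEquiv N a) (eulerEquiv N b) ↔
      (eulerize (⟨fun u v => arc u v⟩ : Digraph (Fin N))).Adj a b := by
  have inj : ∀ {p q : EulerVertex (Fin N)} {m : ℕ}, (eulerEquiv N p : ℕ) = m →
      (eulerEquiv N q : ℕ) = m → p = q := fun h h' =>
    (eulerEquiv N).injective (Fin.ext (h.trans h'.symm))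
  constructor
  · rintro ⟨u, hu, v, hv, h⟩
    lift u to Fin N using hu
    lift v to Fin N using hv
    rcases h with ⟨⟨h₁, h₂⟩, h⟩ | ⟨⟨h₁, h₂⟩, h⟩ | ⟨h₁, h₂⟩ | ⟨⟨h₁, h₂⟩, h⟩ | ⟨h₁, h₂⟩ |
      ⟨⟨h₁, h₂⟩, h⟩ | ⟨⟨h₁, h₂⟩, h⟩ | ⟨h₁, h₂⟩ | ⟨h₁, h₂⟩
    · obtain rfl := inj h₁ (eulerEquiv_base u)
      obtain rfl := inj h₂ (eulerEquiv_base v)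
      exact .arc h
    · obtain rfl := inj h₁ (eulerEquiv_base v)
      obtain rfl := inj h₂ (eulerEquiv_toHub u v)
      exact .leave (h.imp_left Fin.ext)
    · obtain rfl := inj h₁ (eulerEquiv_toHub u v)
      obtain rfl := inj h₂ eulerEquiv_hub
      exact .arrive u v
    · obtain rfl := inj h₁ eulerEquiv_hub
      obtain rfl := inj h₂ (eulerEquiv_toHub u v)
      exact .back (fun h' => h (h'.imp_left (congrArg _)))
    · obtain rfl := inj h₁ eulerEquiv_hub
      obtain rfl := inj h₂ (eulerEquiv_fromHub u v)
      exact .depart u v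
    · obtain rfl := inj h₁ (eulerEquiv_fromHub u v)
      obtain rfl := inj h₂ (eulerEquiv_base u)
      exact .enter (h.imp_left Fin.ext)
    · obtain rfl := inj h₁ (eulerEquiv_fromHub u v)
      obtain rfl := inj h₂ eulerEquiv_hub
      exact .goBack (fun h' => h (h'.imp_left (congrArg _)))
    · obtain rfl := inj h₁ eulerEquiv_hub
      obtain rfl := inj h₂ eulerEquiv_spare
      exact .toSpare
    · obtain rfl := inj h₁ eulerEquiv_spare
      obtain rfl := inj h₂ eulerEquiv_hub
      exact .ofSpare
  · intro h
    have h' : ∀ u v : Fin N, (u = v ∨ arc u v) ↔ ((u : ℕ) = v ∨ arc u v) := fun u v => by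
      rw [Fin.ext_iff]
    cases h with
    | @arc u v h =>
      exact ⟨u, u.2, v, v.2, .inl ⟨⟨eulerEquiv_base u, eulerEquiv_base v⟩, h⟩⟩
    | @leave u v h =>
      exact ⟨u, u.2, v, v.2,
        .inr (.inl ⟨⟨eulerEquiv_base v, eulerEquiv_toHub u v⟩, (h' u v).1 h⟩)⟩
    | arrive u v =>
      exact ⟨u, u.2, v, v.2, .inr (.inr (.inl ⟨eulerEquiv_toHub u v, eulerEquiv_hub⟩))⟩
    | @back u v h =>
      exact ⟨u, u.2, v, v.2, .inr (.inr (.inr (.inl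
        ⟨⟨eulerEquiv_hub, eulerEquiv_toHub u v⟩, fun h'' => h ((h' u v).2 h'')⟩)))⟩
    | depart u v =>
      exact ⟨u, u.2, v, v.2, .inr (.inr (.inr (.inr (.inl
        ⟨eulerEquiv_hub, eulerEquiv_fromHub u v⟩))))⟩
    | @enter u v h =>
      exact ⟨u, u.2, v, v.2, .inr (.inr (.inr (.inr (.inr (.inl
        ⟨⟨eulerEquiv_fromHub u v, eulerEquiv_base u⟩, (h' u v).1 h⟩)))))⟩
    | @goBack u v h =>
      exact ⟨u, u.2, v, v.2, .inr (.inr (.inr (.inr (.inr (.inr (.inl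
        ⟨⟨eulerEquiv_fromHub u v, eulerEquiv_hub⟩, fun h'' => h ((h' u v).2 h'')⟩))))))⟩
    | toSpare =>
      exact ⟨0, hN, 0, hN, .inr (.inr (.inr (.inr (.inr (.inr (.inr (.inl
        ⟨eulerEquiv_hub, eulerEquiv_spare⟩)))))))⟩
    | ofSpare =>
      exact ⟨0, hN, 0, hN, .inr (.inr (.inr (.inr (.inr (.inr (.inr (.inr
        ⟨eulerEquiv_spare, eulerEquiv_hub⟩)))))))⟩

end

/-! ### Numbering the grid -/

/-- The number of a root. -/
def rootCode (K i j : ℕ) : ℕ := i * K + j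

/-- The number of a mate. -/
def mateCode (K i j : ℕ) : ℕ := K * K + (i * K + j)

/-- The number of a node. -/
def nodeCode (K M i t l : ℕ) : ℕ := K * K + K * K + ((i * (M * K) + t) * 2 + l)

/-- The arcs of the grid, with its vertices numbered. -/
def GridArc (K M : ℕ) (compat : ℕ → ℕ → ℕ → ℕ → Prop) (p q : ℕ) : Prop :=
  ∃ i < K, ∃ j < K, ∃ t < M * K, ∃ u < M, ∃ v < M,
    (p = rootCode K i i ∧ q = nodeCode K M i 0 0) ∨
    ((p = nodeCode K M i t 1 ∧ q = rootCode K i i) ∧ t + 1 = M * K) ∨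
    ((p = nodeCode K M i t 0 ∧ q = nodeCode K M i (t + 1) 0) ∧ t + 1 < M * K) ∨
    ((p = nodeCode K M i t 1 ∧ q = nodeCode K M i (t + 1) 1) ∧ t + 1 < M * K) ∨
    ((p = nodeCode K M i t 0 ∧ q = nodeCode K M i ((u + 2) * K) 1) ∧
      u + 2 < M ∧ t + 1 = (u + 1) * K) ∨
    (p = nodeCode K M i t 0 ∧ q = nodeCode K M i t 1) ∨
    ((p = rootCode K i j ∧ q = nodeCode K M i (u * K + j) 0) ∧ i < j) ∨
    ((p = nodeCode K M i (u * K + j) 1 ∧ q = nodeCode K M j (v * K + i) 0) ∧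
      i < j ∧ compat i u j v) ∨
    ((p = nodeCode K M j (v * K + i) 1 ∧ q = rootCode K i j) ∧ i < j) ∨
    ((p = rootCode K i j ∧ q = mateCode K i j) ∧ j < i) ∨
    ((p = mateCode K i j ∧ q = rootCode K i j) ∧ j < i)

/-- The number of vertices of the grid. -/
def gridSize (K M : ℕ) : ℕ := K * K + K * K + K * (M * K) * 2

open GridVertex

/-- The number of a vertex of the grid. -/
def gridCode (K M : ℕ) : GridVertex → ℕ
  | root i j => rootCode K i j
  | mate i j => mateCode K i j
  | node i t l => nodeCode K M i t l

/-- The vertices of the grid that are not isolated. -/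
def IsProper (K M : ℕ) : GridVertex → Prop
  | root i j => i < K ∧ j < K
  | mate i j => i < K ∧ j < K
  | node i t l => i < K ∧ t < M * K ∧ l < 2

variable {K M : ℕ} {compat : ℕ → ℕ → ℕ → ℕ → Prop}

theorem gridArc_iff (hM : 0 < M) {p q : ℕ} : GridArc K M compat p q ↔
    ∃ a b, GridAdj K M compat a b ∧ p = gridCode K M a ∧ q = gridCode K M b := by
  constructor
  · rintro ⟨i, hi, j, hj, t, ht, u, hu, v, hv, h⟩
    rcases h with h | ⟨h, h₁⟩ | ⟨h, h₁⟩ | ⟨h, h₁⟩ | ⟨h, h₁, h₂⟩ | h | ⟨h, h₁⟩ | ⟨h, h₁, h₂⟩ |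
      ⟨h, h₁⟩ | ⟨h, h₁⟩ | ⟨h, h₁⟩
    · exact ⟨root i i, node i 0 0, .start hi, h⟩
    · exact ⟨node i t 1, root i i, .finish hi h₁, h⟩
    · exact ⟨node i t 0, node i (t + 1) 0, .step hi h₁ (by omega), h⟩
    · exact ⟨node i t 1, node i (t + 1) 1, .step hi h₁ (by omega), h⟩
    · exact ⟨node i t 0, node i ((u + 2) * K) 1, .skip hi h₁ h₂, h⟩
    · exact ⟨node i t 0, node i t 1, .down hi ht, h⟩
    · exact ⟨root i j, node i (u * K + j) 0, .enter h₁ hj hu, h⟩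
    · exact ⟨node i (u * K + j) 1, node j (v * K + i) 0, .cross h₁ hj hu hv h₂, h⟩
    · exact ⟨node j (v * K + i) 1, root i j, .exit h₁ hj hv, h⟩
    · exact ⟨root i j, mate i j, .toMate h₁ hi, h⟩
    · exact ⟨mate i j, root i j, .ofMate h₁ hi, h⟩
  · rintro ⟨a, b, h, hp⟩
    have h₀ : ∀ {i}, i < K → 0 < M * K := fun hi => Nat.mul_pos hM (by omega)
    cases h with
    | @start i hi => exact ⟨i, hi, i, hi, 0, h₀ hi, 0, hM, 0, hM, .inl hp⟩
    | @finish i t hi ht =>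
      exact ⟨i, hi, i, hi, t, by omega, 0, hM, 0, hM, .inr (.inl ⟨hp, ht⟩)⟩
    | @step i t l hi ht hl =>
      have hl' : l = 0 ∨ l = 1 := by omega
      rcases hl' with rfl | rfl
      · exact ⟨i, hi, i, hi, t, by omega, 0, hM, 0, hM, .inr (.inr (.inl ⟨hp, ht⟩))⟩
      · exact ⟨i, hi, i, hi, t, by omega, 0, hM, 0, hM, .inr (.inr (.inr (.inl ⟨hp, ht⟩)))⟩
    | @skip i t w hi hw ht =>
      have : (w + 1) * K ≤ M * K := Nat.mul_le_mul_right _ (by omega)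
      exact ⟨i, hi, i, hi, t, by omega, w, by omega, 0, hM,
        .inr (.inr (.inr (.inr (.inl ⟨hp, hw, ht⟩))))⟩
    | @down i t hi ht =>
      exact ⟨i, hi, i, hi, t, ht, 0, hM, 0, hM, .inr (.inr (.inr (.inr (.inr (.inl hp)))))⟩
    | @enter i j u hij hj hu =>
      exact ⟨i, by omega, j, hj, 0, h₀ hj, u, hu, 0, hM,
        .inr (.inr (.inr (.inr (.inr (.inr (.inl ⟨hp, hij⟩))))))⟩
    | @cross i j u v hij hj hu hv hc =>
      exact ⟨i, by omega, j, hj, 0, h₀ hj, u, hu, v, hv,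
        .inr (.inr (.inr (.inr (.inr (.inr (.inr (.inl ⟨hp, hij, hc⟩)))))))⟩
    | @exit i j v hij hj hv =>
      exact ⟨i, by omega, j, hj, 0, h₀ hj, 0, hM, v, hv,
        .inr (.inr (.inr (.inr (.inr (.inr (.inr (.inr (.inl ⟨hp, hij⟩))))))))⟩
    | @toMate i j hij hi =>
      exact ⟨i, hi, j, by omega, 0, h₀ hi, 0, hM, 0, hM,
        .inr (.inr (.inr (.inr (.inr (.inr (.inr (.inr (.inr (.inl ⟨hp, hij⟩)))))))))⟩
    | @ofMate i j hij hi =>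
      exact ⟨i, hi, j, by omega, 0, h₀ hi, 0, hM, 0, hM,
        .inr (.inr (.inr (.inr (.inr (.inr (.inr (.inr (.inr (.inr ⟨hp, hij⟩)))))))))⟩

theorem GridAdj.isProper {a b : GridVertex} (hM : 0 < M) (h : GridAdj K M compat a b) :
    IsProper K M a ∧ IsProper K M b := by
  cases h with
  | start hi => exact ⟨⟨hi, hi⟩, hi, Nat.mul_pos hM (by omega), by omega⟩
  | finish hi ht => exact ⟨⟨hi, by omega, by omega⟩, hi, hi⟩
  | step hi ht hl => exact ⟨⟨hi, by omega, hl⟩, hi, ht, hl⟩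
  | @skip i t w hi hw ht =>
    have h₁ : (w + 2) * K = (w + 1) * K + K := by ring
    have h₂ : (w + 2) * K < M * K := Nat.mul_lt_mul_of_pos_right hw (by omega)
    exact ⟨⟨hi, by omega, by omega⟩, hi, h₂, by omega⟩
  | down hi ht => exact ⟨⟨hi, ht, by omega⟩, hi, ht, by omega⟩
  | enter hij hj hu =>
    exact ⟨⟨by omega, hj⟩, by omega, mul_add_lt_mul hu hj, by omega⟩
  | cross hij hj hu hv _ =>
    exact ⟨⟨by omega, mul_add_lt_mul hu hj, by omega⟩, hj, mul_add_lt_mul hv (by omega), by omega⟩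
  | exit hij hj hv =>
    exact ⟨⟨hj, mul_add_lt_mul hv (by omega), by omega⟩, by omega, hj⟩
  | toMate hij hi => exact ⟨⟨hi, by omega⟩, hi, by omega⟩
  | ofMate hij hi => exact ⟨⟨hi, by omega⟩, hi, by omega⟩

theorem gridCode_lt {a : GridVertex} (ha : IsProper K M a) : gridCode K M a < gridSize K M := by
  cases a with
  | root i j =>
    have := mul_add_lt_mul ha.1 ha.2
    simp only [gridCode, rootCode, gridSize]; omega
  | mate i j =>
    have := mul_add_lt_mul ha.1 ha.2
    simp only [gridCode, mateCode, gridSize]; omega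
  | node i t l =>
    have := mul_add_lt_mul ha.1 ha.2.1
    have := ha.2.2
    simp only [gridCode, nodeCode, gridSize]; omega

theorem mul_add_inj {n i j i' j' : ℕ} (hj : j < n) (hj' : j' < n)
    (h : i * n + j = i' * n + j') : i = i' ∧ j = j' := by
  have h₁ := congrArg (· / n) h
  have h₂ := congrArg (· % n) h
  simp only [Nat.mul_comm _ n, Nat.mul_add_div (show 0 < n by omega), Nat.div_eq_of_lt hj,
    Nat.div_eq_of_lt hj', Nat.mul_add_mod, Nat.mod_eq_of_lt hj, Nat.mod_eq_of_lt hj'] at h₁ h₂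
  exact ⟨h₁, h₂⟩

theorem gridCode_injOn : Set.InjOn (gridCode K M) {a | IsProper K M a} := by
  intro a ha b hb h
  change IsProper K M a at ha
  change IsProper K M b at hb
  cases a with
  | root i j =>
    have h₁ := mul_add_lt_mul ha.1 ha.2
    cases b with
    | root i' j' =>
      obtain ⟨rfl, rfl⟩ := mul_add_inj ha.2 hb.2 h
      rfl
    | mate i' j' => simp only [gridCode, rootCode, mateCode] at h; omega
    | node i' t' l' => simp only [gridCode, rootCode, nodeCode] at h; omega
  | mate i j =>
    have h₁ := mul_add_lt_mul ha.1 ha.2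
    cases b with
    | root i' j' =>
      have h₂ := mul_add_lt_mul hb.1 hb.2
      simp only [gridCode, rootCode, mateCode] at h; omega
    | mate i' j' =>
      obtain ⟨rfl, rfl⟩ := mul_add_inj ha.2 hb.2 (Nat.add_left_cancel h)
      rfl
    | node i' t' l' => simp only [gridCode, mateCode, nodeCode] at h; omega
  | node i t l =>
    cases b with
    | root i' j' =>
      have h₂ := mul_add_lt_mul hb.1 hb.2
      simp only [gridCode, rootCode, nodeCode] at h; omega
    | mate i' j' =>
      have h₂ := mul_add_lt_mul hb.1 hb.2
      simp only [gridCode, mateCode, nodeCode] at h; omega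
    | node i' t' l' =>
      obtain ⟨h₁, rfl⟩ := mul_add_inj ha.2.2 hb.2.2 (Nat.add_left_cancel h)
      obtain ⟨rfl, rfl⟩ := mul_add_inj ha.2.1 hb.2.1 h₁
      rfl

/-- The grid, with its vertices numbered. -/
def finGrid (K M : ℕ) (compat : ℕ → ℕ → ℕ → ℕ → Prop) : Digraph (Fin (gridSize K M)) :=
  ⟨fun p q => GridArc K M compat p q⟩

theorem finGrid_loopless (hM : 0 < M) : (finGrid K M compat).Loopless := by
  intro p hp
  obtain ⟨a, b, hab, h₁, h₂⟩ := (gridArc_iff hM).1 hp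
  have := gridCode_injOn (hab.isProper hM).1 (hab.isProper hM).2 (h₁.symm.trans h₂)
  subst this
  exact grid_loopless _ hab

theorem gridSize_pos (hK : 0 < K) : 0 < gridSize K M := by
  have := Nat.mul_pos hK hK
  rw [gridSize]; omega

/-- Vertices with indices out of range are isolated, and the numbering is injective on the others.
So families of cycles can be carried over in both directions. -/
theorem finGrid_hasDisjointCycles_iff (hK : 0 < K) (hM : 0 < M) {k : ℕ} :
    (finGrid K M compat).HasDisjointCycles k ↔ (grid K M compat).HasDisjointCycles k := by
  classical
  constructor
  · let f : Fin (gridSize K M) → GridVertex := fun p =>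
      if h : ∃ a, IsProper K M a ∧ gridCode K M a = p then h.choose else root 0 0
    have hf : ∀ a, IsProper K M a → ∀ p : Fin (gridSize K M), (p : ℕ) = gridCode K M a →
        f p = a := by
      intro a ha p hp
      have h : ∃ a, IsProper K M a ∧ gridCode K M a = p := ⟨a, ha, hp.symm⟩
      simp only [f, dif_pos h]
      exact gridCode_injOn h.choose_spec.1 ha (h.choose_spec.2.trans hp)
    refine fun h => h.map f (fun p q hpq => ?_) ?_
    · obtain ⟨a, b, hab, h₁, h₂⟩ := (gridArc_iff hM).1 hpq
      rw [hf a (hab.isProper hM).1 p h₁, hf b (hab.isProper hM).2 q h₂]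
      exact hab
    · rintro p ⟨q, hpq⟩ p' ⟨q', hpq'⟩ e
      obtain ⟨a, b, hab, h₁, -⟩ := (gridArc_iff hM).1 hpq
      obtain ⟨a', b', hab', h₁', -⟩ := (gridArc_iff hM).1 hpq'
      rw [hf a (hab.isProper hM).1 p h₁, hf a' (hab'.isProper hM).1 p' h₁'] at e
      exact Fin.ext (by rw [h₁, h₁', e])
  · let f : GridVertex → Fin (gridSize K M) := fun a =>
      if h : gridCode K M a < gridSize K M then ⟨gridCode K M a, h⟩ else ⟨0, gridSize_pos hK⟩
    have hf : ∀ a, IsProper K M a → (f a : ℕ) = gridCode K M a := by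
      intro a ha
      simp only [f, dif_pos (gridCode_lt ha)]
    refine fun h => h.map f (fun a b hab => ?_) ?_
    · exact (gridArc_iff hM).2 ⟨a, b, hab, hf a (GridAdj.isProper hM hab).1,
        hf b (GridAdj.isProper hM hab).2⟩
    · rintro a ⟨b, hab⟩ a' ⟨b', hab'⟩ e
      have h₁ := (GridAdj.isProper hM hab).1
      have h₂ := (GridAdj.isProper hM hab').1
      exact gridCode_injOn h₁ h₂ (by rw [← hf a h₁, ← hf a' h₂, e])

/-! ### The numbered Eulerian extension of the grid -/

/-- The Eulerian extension of the grid, with its vertices numbered. -/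
def finEuler (K M : ℕ) (compat : ℕ → ℕ → ℕ → ℕ → Prop) :
    Digraph (Fin (eulerSize (gridSize K M))) :=
  ⟨fun x y => EulerArc (gridSize K M) (GridArc K M compat) x y⟩

section

theorem finEuler_adj (hK : 0 < K) (x y : Fin (eulerSize (gridSize K M))) :
    (finEuler K M compat).Adj x y ↔ (finGrid K M compat).eulerize.Adj
      ((eulerEquiv _).symm x) ((eulerEquiv _).symm y) := by
  have := eulerArc_iff (gridSize_pos (M := M) hK) (GridArc K M compat)
    ((eulerEquiv _).symm x) ((eulerEquiv _).symm y)
  rw [Equiv.apply_symm_apply, Equiv.apply_symm_apply] at this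
  exact this

theorem finEuler_loopless (hK : 0 < K) (hM : 0 < M) : (finEuler K M compat).Loopless :=
  (eulerize_loopless (finGrid_loopless hM)).of_iso _ (finEuler_adj hK)

theorem finEuler_isEuler (hK : 0 < K) (hM : 0 < M) : (finEuler K M compat).IsEuler :=
  (eulerize_isEuler (finGrid_loopless hM)).of_iso _ (finEuler_adj hK)

theorem finEuler_hasDisjointCycles_iff (hK : 0 < K) (hM : 0 < M) {k : ℕ} :
    (finEuler K M compat).HasDisjointCycles (k + 1) ↔ (grid K M compat).HasDisjointCycles k := by
  rw [hasDisjointCycles_congr _ (finEuler_adj hK), ← finGrid_hasDisjointCycles_iff hK hM]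
  exact ⟨HasDisjointCycles.of_eulerize, HasDisjointCycles.eulerize⟩

end

/-- The string determines the digraph: its length gives the number of vertices, its symbols give the
arcs. -/
theorem encode_mem_iff {n : ℕ} (D : Digraph (Fin n)) (hD : D.Loopless) (k : ℕ) :
    (D.encode, k) ∈ vertexDisjointCycles ↔ D.HasDisjointCycles k := by
  constructor
  · rintro ⟨n', D', -, h, hk⟩
    change D.encode = D'.encode at h
    have hn : n = n' := by
      have := congrArg List.length h
      rw [encode, encode, ParamComplexity.length_encodeMatrix,
        ParamComplexity.length_encodeMatrix] at this
      exact Nat.mul_self_inj.1 this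
    subst hn
    have := ParamComplexity.encodeMatrix_injective h
    have hDD : D = D' := by
      ext u v
      simpa using congrFun (congrFun this u) v
    subst hDD
    exact hk
  · exact fun h => ⟨n, D, hD, rfl, h⟩

end Digraph

namespace RAM

/-! ## Arithmetic expressions and their compilation -/

/-- Arithmetic expressions over natural number variables, with access to one array. -/
inductive Expr : Type
  | var (x : ℕ) : Expr
  | const (c : ℕ) : Expr
  | add (a b : Expr) : Expr
  | sub (a b : Expr) : Expr
  | mul (a b : Expr) : Expr
  /-- `1` if the cell of the array at the index `a` holds `2`, and `0` otherwise -/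
  | bit (a : Expr) : Expr
  /-- the sum of the values of `e` where `x` runs through the numbers below `b` -/
  | sum (x : ℕ) (b e : Expr) : Expr

namespace Expr

/-- The value of an expression. -/
def eval (A : ℕ → ℕ) : Expr → (ℕ → ℕ) → ℕ
  | var x, s => s x
  | const c, _ => c
  | add a b, s => eval A a s + eval A b s
  | sub a b, s => eval A a s - eval A b s
  | mul a b, s => eval A a s * eval A b s
  | bit a, s => if A (eval A a s) = 2 then 1 else 0
  | sum x b e, s => ∑ i ∈ Finset.range (eval A b s), eval A e (Function.update s x i)

/-- A bound for the number of steps that the compiled expression takes. -/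
def cost (A : ℕ → ℕ) : Expr → (ℕ → ℕ) → ℕ
  | var _, _ => 2
  | const _, _ => 1
  | add a b, s => cost A a s + cost A b s + 1
  | sub a b, s => cost A a s + cost A b s + 1
  | mul a b, s => cost A a s + cost A b s + eval A a s * 3 + 5
  | bit a, s => cost A a s + 7
  | sum x b e, s =>
    cost A b s + ∑ i ∈ Finset.range (eval A b s), (cost A e (Function.update s x i) + 5) + 9

/-- All variables of an expression, free or bound, are less than `n`. -/
def Below (n : ℕ) : Expr → Bool
  | var x => x < n
  | const _ => true
  | add a b => Below n a && Below n b
  | sub a b => Below n a && Below n b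
  | mul a b => Below n a && Below n b
  | bit a => Below n a
  | sum x b e => x < n && Below n b && Below n e

theorem Below.mono {n m : ℕ} (hnm : n ≤ m) {e : Expr} (h : e.Below n) : e.Below m := by
  induction e <;> simp_all [Below] <;> omega

theorem eval_cost_congr (A : ℕ → ℕ) {n : ℕ} {e : Expr} (he : e.Below n) {s s' : ℕ → ℕ}
    (h : ∀ r < n, s r = s' r) : e.eval A s = e.eval A s' ∧ e.cost A s = e.cost A s' := by
  induction e generalizing s s' with
  | var x => simp_all [Below, eval, cost]
  | const c => simp [eval, cost]
  | add a b iha ihb =>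
    simp only [Below, Bool.and_eq_true] at he
    simp [eval, cost, iha he.1 h, ihb he.2 h]
  | sub a b iha ihb =>
    simp only [Below, Bool.and_eq_true] at he
    simp [eval, cost, iha he.1 h, ihb he.2 h]
  | mul a b iha ihb =>
    simp only [Below, Bool.and_eq_true] at he
    simp [eval, cost, iha he.1 h, ihb he.2 h]
  | bit a ih => simp [eval, cost, ih he h]
  | sum x b e ihb ihe =>
    simp only [Below, Bool.and_eq_true, decide_eq_true_eq] at he
    have h' : ∀ i, ∀ r < n, Function.update s x i r = Function.update s' x i r := by
      intro i r hr
      by_cases hrx : r = x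
      · simp [hrx]
      · simp [hrx, h r hr]
    simp only [eval, cost, (ihb he.1.2 h).1, (ihb he.1.2 h).2]
    exact ⟨Finset.sum_congr rfl fun i _ => (ihe he.2 (h' i)).1, by
      rw [Finset.sum_congr rfl fun i _ => by rw [(ihe he.2 (h' i)).2]]⟩

end Expr

/-- `reg r := reg a`, for `a ≠ r` -/
def copy (r a : ℕ) : Prog := .seq (.const r 0) (.add r a r)

/-- A program that evaluates the expression into the register `t` and does not change the registers
before it. -/
def compile : Expr → ℕ → Prog
  | .var x, t => copy t x
  | .const c, t => .const t c
  | .add a b, t => .seq (compile a t) (.seq (compile b (t + 1)) (.add t t (t + 1)))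
  | .sub a b, t => .seq (compile a t) (.seq (compile b (t + 1)) (.sub t t (t + 1)))
  | .mul a b, t => .seq (compile a t) (.seq (compile b (t + 1)) (.seq (.const (t + 2) 0)
      (.seq (.const (t + 3) 1) (.seq
        (.loop t (.seq (.add (t + 2) (t + 2) (t + 1)) (.sub t t (t + 3)))) (copy t (t + 2))))))
  | .bit a, t => .seq (compile a t) (.seq (.load t 1 t) (.seq (.const (t + 1) 2)
      (.seq (.sub (t + 2) t (t + 1)) (.seq (.sub (t + 3) (t + 1) t)
        (.seq (.add t (t + 2) (t + 3)) (.seq (.const (t + 1) 1) (.sub t (t + 1) t)))))))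
  | .sum x b e, t => .seq (compile b t) (.seq (copy (t + 1) x) (.seq (.const (t + 2) 0)
      (.seq (.const x 0) (.seq
        (.loop t (.seq (compile e (t + 3)) (.seq (.add (t + 2) (t + 2) (t + 3))
          (.seq (.const (t + 3) 1) (.seq (.add x x (t + 3)) (.sub t t (t + 3)))))))
        (.seq (copy x (t + 1)) (copy t (t + 2)))))))

theorem Exec.copy (s : State) {r a : ℕ} (h : a ≠ r) :
    Exec (copy r a) s 2 (s.setReg r (s.reg a)) := by
  have := Exec.seq (Exec.const s r 0) (Exec.add (s.setReg r 0) r a r)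
  convert! this using 1
  simp [State.setReg, h]

/-- A loop that runs `N` times and keeps the invariant `I`. -/
theorem Exec.loop_count {r : ℕ} {p : Prog} {N : ℕ} {I : ℕ → State → Prop} {c : ℕ → ℕ}
    (hstep : ∀ i < N, ∀ s, I i s → s.reg r ≠ 0 ∧
      ∃ n s', Exec p s n s' ∧ n ≤ c i ∧ I (i + 1) s')
    (hdone : ∀ s, I N s → s.reg r = 0) {s : State} (hs : I 0 s) :
    ∃ n s', Exec (.loop r p) s n s' ∧ n ≤ ∑ j ∈ Finset.range N, (c j + 1) + 1 ∧ I N s' := by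
  suffices h : ∀ m i s, i + m = N → I i s → ∃ n s', Exec (.loop r p) s n s' ∧
      n ≤ ∑ j ∈ Finset.range m, (c (i + j) + 1) + 1 ∧ I N s' by
    simpa using h N 0 s (Nat.zero_add N) hs
  intro m
  induction m with
  | zero =>
    rintro i s rfl hi
    exact ⟨1, s, .loopDone (hdone s hi), by simp, hi⟩
  | succ m ih =>
    intro i s hN hi
    obtain ⟨hr, n, s', hp, hn, hi'⟩ := hstep i (by omega) s hi
    obtain ⟨n', s'', hp', hn', hi''⟩ := ih (i + 1) s' (by omega) hi'
    refine ⟨1 + n + n', s'', .loopStep hr hp hp', ?_, hi''⟩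
    rw [Finset.sum_range_succ']
    simp only [Nat.add_zero, ← Nat.add_assoc, Nat.add_right_comm i _ 1] at hn' ⊢
    omega

/-- The variables occupy registers below `t`, and scratch space begins at `t`. A subexpression that
is evaluated later starts further up and therefore spares the earlier results. -/
theorem compile_exec {e : Expr} {t : ℕ} (he : e.Below t) (s : State) :
    ∃ n s', Exec (compile e t) s n s' ∧ n ≤ e.cost (s.arr 1) s.reg ∧ s'.arr = s.arr ∧
      s'.reg t = e.eval (s.arr 1) s.reg ∧ ∀ r < t, s'.reg r = s.reg r := by
  have two : ∀ {a b : Expr} {t : ℕ}, a.Below t → b.Below t →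
      (∀ {t : ℕ}, a.Below t → ∀ s : State, ∃ n s', Exec (compile a t) s n s' ∧
        n ≤ a.cost (s.arr 1) s.reg ∧ s'.arr = s.arr ∧ s'.reg t = a.eval (s.arr 1) s.reg ∧
        ∀ r < t, s'.reg r = s.reg r) →
      (∀ {t : ℕ}, b.Below t → ∀ s : State, ∃ n s', Exec (compile b t) s n s' ∧
        n ≤ b.cost (s.arr 1) s.reg ∧ s'.arr = s.arr ∧ s'.reg t = b.eval (s.arr 1) s.reg ∧
        ∀ r < t, s'.reg r = s.reg r) →
      ∀ s : State, ∃ n₁ s₁ n₂ s₂, Exec (compile a t) s n₁ s₁ ∧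
        Exec (compile b (t + 1)) s₁ n₂ s₂ ∧
        n₁ ≤ a.cost (s.arr 1) s.reg ∧ n₂ ≤ b.cost (s.arr 1) s.reg ∧ s₂.arr = s.arr ∧
        s₂.reg t = a.eval (s.arr 1) s.reg ∧ s₂.reg (t + 1) = b.eval (s.arr 1) s.reg ∧
        ∀ r < t, s₂.reg r = s.reg r := by
    intro a b t ha hb iha ihb s
    obtain ⟨n₁, s₁, h₁, hn₁, harr₁, hv₁, hr₁⟩ := iha ha s
    obtain ⟨n₂, s₂, h₂, hn₂, harr₂, hv₂, hr₂⟩ := ihb (Expr.Below.mono (Nat.le_succ t) hb) s₁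
    have hc := b.eval_cost_congr (s.arr 1) hb hr₁
    rw [harr₁] at hn₂ hv₂
    refine ⟨n₁, s₁, n₂, s₂, h₁, h₂, hn₁, hn₂.trans_eq hc.2, harr₂.trans harr₁,
      (hr₂ t (by omega)).trans hv₁, hv₂.trans hc.1, fun r hr => ?_⟩
    rw [hr₂ r (by omega), hr₁ r hr]
  induction e generalizing t s with
  | var x =>
    simp only [Expr.Below, decide_eq_true_eq] at he
    refine ⟨2, _, Exec.copy s he.ne, le_rfl, rfl, by simp [State.setReg, Expr.eval], ?_⟩
    intro r hr
    simp [State.setReg, hr.ne]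
  | const c =>
    refine ⟨1, _, Exec.const s t c, le_rfl, rfl, by simp [State.setReg, Expr.eval], ?_⟩
    intro r hr
    simp [State.setReg, hr.ne]
  | add a b iha ihb =>
    simp only [Expr.Below, Bool.and_eq_true] at he
    obtain ⟨n₁, s₁, n₂, s₂, h₁, h₂, hn₁, hn₂, harr, hv₁, hv₂, hr⟩ := two he.1 he.2 iha ihb s
    refine ⟨_, _, .seq h₁ (.seq h₂ (.add _ _ _ _)), ?_, harr, ?_, fun r hrt => ?_⟩
    · simp only [Expr.cost]; omega
    · simp [State.setReg, hv₁, hv₂, Expr.eval]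
    · simp [State.setReg, hrt.ne, hr r hrt]
  | sub a b iha ihb =>
    simp only [Expr.Below, Bool.and_eq_true] at he
    obtain ⟨n₁, s₁, n₂, s₂, h₁, h₂, hn₁, hn₂, harr, hv₁, hv₂, hr⟩ := two he.1 he.2 iha ihb s
    refine ⟨_, _, .seq h₁ (.seq h₂ (.sub _ _ _ _)), ?_, harr, ?_, fun r hrt => ?_⟩
    · simp only [Expr.cost]; omega
    · simp [State.setReg, hv₁, hv₂, Expr.eval]
    · simp [State.setReg, hrt.ne, hr r hrt]
  | mul a b iha ihb =>
    simp only [Expr.Below, Bool.and_eq_true] at he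
    obtain ⟨n₁, s₁, n₂, s₂, h₁, h₂, hn₁, hn₂, harr, hv₁, hv₂, hr⟩ := two he.1 he.2 iha ihb s
    set N := a.eval (s.arr 1) s.reg with hN
    set m := b.eval (s.arr 1) s.reg with hm
    -- Repeated addition: `t` counts down, `t + 2` accumulates, `t + 3` holds the constant `1`.
    obtain ⟨n₃, s₃, h₃, hn₃, harr₃, hv₃, hv₃', -, -, hr₃⟩ := Exec.loop_count (r := t)
      (p := .seq (.add (t + 2) (t + 2) (t + 1)) (.sub t t (t + 3))) (N := N) (c := fun _ => 2)
      (I := fun i s' => s'.arr = s.arr ∧ s'.reg t = N - i ∧ s'.reg (t + 2) = i * m ∧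
        s'.reg (t + 1) = m ∧ s'.reg (t + 3) = 1 ∧ ∀ r < t, s'.reg r = s.reg r)
      (s := (s₂.setReg (t + 2) 0).setReg (t + 3) 1)
      (by
          rintro i hi s' ⟨ha', hc₁, hc₂, hc₃, hc₄, hc₅⟩
          refine ⟨by omega, _, _, .seq (.add _ _ _ _) (.sub _ _ _ _), le_rfl, ha', ?_, ?_, ?_, ?_, ?_⟩
          · simp [State.setReg, hc₁, hc₄]; omega
          · simp [State.setReg, hc₂, hc₃]; ring
          · simp [State.setReg, hc₃]
          · simp [State.setReg, hc₄]
          · intro r hrt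
            simp [State.setReg, hrt.ne, hc₅ r hrt, show r ≠ t + 2 by omega])
      (by
          rintro s' ⟨-, h, -⟩
          omega)
      (by
          refine ⟨harr, ?_, ?_, ?_, ?_, ?_⟩
          · simp [State.setReg, hv₁]
          · simp [State.setReg]
          · simp [State.setReg, hv₂]
          · simp [State.setReg]
          · intro r hrt
            simp [State.setReg, hr r hrt, show r ≠ t + 2 by omega, show r ≠ t + 3 by omega])
    refine ⟨_, _, .seq h₁ (.seq h₂ (.seq (.const _ _ _) (.seq (.const _ _ _)
      (.seq h₃ (Exec.copy _ (by omega)))))), ?_, harr₃, ?_, fun r hrt => ?_⟩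
    · simp only [Expr.cost]
      simp at hn₃
      omega
    · simp [State.setReg, hv₃', Expr.eval, N, m]
    · simp [State.setReg, hrt.ne, hr₃ r hrt]
  | bit a ih =>
    obtain ⟨n₁, s₁, h₁, hn₁, harr₁, hv₁, hr₁⟩ := ih he s
    refine ⟨_, _, .seq h₁ (.seq (.load _ _ _ _) (.seq (.const _ _ _) (.seq (.sub _ _ _ _)
      (.seq (.sub _ _ _ _) (.seq (.add _ _ _ _) (.seq (.const _ _ _) (.sub _ _ _ _))))))),
      ?_, harr₁, ?_, fun r hrt => ?_⟩
    · simp only [Expr.cost]; omega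
    -- For the content `a` of the cell, the result is `1 - ((a - 2) + (2 - a))` in truncated
    -- subtraction.
    · simp only [State.setReg, hv₁, harr₁, Expr.eval]
      simp
      split_ifs <;> omega
    · simp [State.setReg, hrt.ne, hr₁ r hrt, show r ≠ t + 1 by omega, show r ≠ t + 2 by omega,
        show r ≠ t + 3 by omega]
  | sum x b e ihb ihe =>
    simp only [Expr.Below, Bool.and_eq_true, decide_eq_true_eq] at he
    obtain ⟨⟨hx, hb⟩, he⟩ := he
    obtain ⟨n₁, s₁, h₁, hn₁, harr₁, hv₁, hr₁⟩ := ihb hb s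
    set N := b.eval (s.arr 1) s.reg with hN
    -- Register `t` counts down, `x` counts up and `t + 2` accumulates, while `t + 1` keeps the old
    -- value of `x`, to be restored after the loop.
    obtain ⟨n₃, s₃, h₃, hn₃, harr₃, hv₃, hv₃', hv₃'', hv₃''', hr₃⟩ := Exec.loop_count (r := t)
      (p := .seq (compile e (t + 3)) (.seq (.add (t + 2) (t + 2) (t + 3))
          (.seq (.const (t + 3) 1) (.seq (.add x x (t + 3)) (.sub t t (t + 3))))))
      (N := N) (c := fun i => e.cost (s.arr 1) (Function.update s.reg x i) + 4)
      (I := fun i s' => s'.arr = s.arr ∧ s'.reg t = N - i ∧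
        s'.reg (t + 2) = ∑ j ∈ Finset.range i, e.eval (s.arr 1) (Function.update s.reg x j) ∧
        s'.reg (t + 1) = s.reg x ∧ s'.reg x = i ∧ ∀ r < t, r ≠ x → s'.reg r = s.reg r)
      (s := ((s₁.setReg (t + 1) (s₁.reg x)).setReg (t + 2) 0).setReg x 0)
      (by
          rintro i hi s' ⟨ha', hc₁, hc₂, hc₃, hc₄, hc₅⟩
          obtain ⟨n₂, s₂, h₂, hn₂, harr₂, hv₂, hr₂⟩ := ihe (Expr.Below.mono (show t ≤ t + 3 by omega) he) s'
          have hc := e.eval_cost_congr (s.arr 1) he (s := s'.reg)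
            (s' := Function.update s.reg x i) (fun r hr => by
              by_cases hrx : r = x
              · simp [hrx, hc₄]
              · simp [hrx, hc₅ r hr hrx])
          rw [ha', hc.1] at hv₂
          rw [ha', hc.2] at hn₂
          refine ⟨by omega, _, _, .seq h₂ (.seq (.add _ _ _ _) (.seq (.const _ _ _)
            (.seq (.add _ _ _ _) (.sub _ _ _ _)))), by omega, harr₂.trans ha', ?_, ?_, ?_, ?_, ?_⟩
          · simp [State.setReg, hr₂ t (by omega), hc₁, show t + 3 ≠ x by omega, show t ≠ x by omega]
            omega
          · simp [State.setReg, hr₂ (t + 2) (by omega), hc₂, hv₂, show t + 2 ≠ x by omega,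
              Finset.sum_range_succ]
          · simp [State.setReg, hr₂ (t + 1) (by omega), hc₃, show t + 1 ≠ x by omega]
          · simp [State.setReg, hr₂ x (by omega), hc₄, show x ≠ t by omega, show x ≠ t + 2 by omega,
              show x ≠ t + 3 by omega]
          · intro r hrt hrx
            simp [State.setReg, hr₂ r (by omega), hc₅ r hrt hrx, hrx, hrt.ne,
              show r ≠ t + 2 by omega, show r ≠ t + 3 by omega])
      (by
          rintro s' ⟨-, h, -⟩
          omega)
      (by
          refine ⟨harr₁, ?_, ?_, ?_, ?_, ?_⟩
          · simp [State.setReg, hv₁, show t ≠ x by omega]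
          · simp [State.setReg, show t + 2 ≠ x by omega]
          · simp [State.setReg, show t + 1 ≠ x by omega, hr₁ x hx]
          · simp [State.setReg]
          · intro r hrt hrx
            simp [State.setReg, hrx, hr₁ r hrt, show r ≠ t + 1 by omega, show r ≠ t + 2 by omega])
    refine ⟨_, _, .seq h₁ (.seq (Exec.copy _ (by omega)) (.seq (.const _ _ _)
      (.seq (.const _ _ _) (.seq h₃ (.seq (Exec.copy _ (by omega)) (Exec.copy _ (by omega))))))),
      ?_, harr₃, ?_, fun r hrt => ?_⟩
    · simp only [Expr.cost]
      simp only [Nat.add_assoc, Nat.reduceAdd, ← hN] at hn₃ ⊢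
      omega
    · simp [State.setReg, hv₃', Expr.eval, N, show t + 2 ≠ x by omega]
    · by_cases hrx : r = x
      · subst hrx
        simp [State.setReg, hv₃'', hrt.ne]
      · simp [State.setReg, hrt.ne, hr₃ r hrt hrx, hrx]

/-! ## Polynomial bounds -/

/-- A function with a polynomial bound. -/
def IsPoly (f : ℕ → ℕ) : Prop := ∃ d, ∀ B, f B ≤ (B + 2) ^ d

namespace IsPoly

variable {f g : ℕ → ℕ}

theorem const (c : ℕ) : IsPoly fun _ => c :=
  ⟨c, fun B => (Nat.lt_pow_self (by omega)).le⟩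

theorem id : IsPoly fun B => B := ⟨1, fun B => by simp⟩

theorem mul (hf : IsPoly f) (hg : IsPoly g) : IsPoly fun B => f B * g B := by
  obtain ⟨d, hd⟩ := hf
  obtain ⟨e, he⟩ := hg
  exact ⟨d + e, fun B => by rw [pow_add]; exact Nat.mul_le_mul (hd B) (he B)⟩

theorem add (hf : IsPoly f) (hg : IsPoly g) : IsPoly fun B => f B + g B := by
  obtain ⟨d, hd⟩ := hf
  obtain ⟨e, he⟩ := hg
  refine ⟨max d e + 1, fun B => ?_⟩
  have h₁ : (B + 2) ^ d ≤ (B + 2) ^ max d e := Nat.pow_le_pow_right (by omega) (le_max_left _ _)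
  have h₂ : (B + 2) ^ e ≤ (B + 2) ^ max d e := Nat.pow_le_pow_right (by omega) (le_max_right _ _)
  have := hd B
  have := he B
  rw [pow_succ]
  nlinarith [Nat.zero_le (B * (B + 2) ^ max d e)]

theorem comp (hf : IsPoly f) (hg : IsPoly g) : IsPoly fun B => f (g B) := by
  obtain ⟨d, hd⟩ := hf
  obtain ⟨e, he⟩ := hg.add (const 2)
  exact ⟨e * d, fun B => (hd _).trans (by rw [pow_mul]; exact Nat.pow_le_pow_left (he B) d)⟩

end IsPoly

namespace Expr

/-- A bound for the values of an expression if its variables have the values at most `B`. -/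
def valueBound : Expr → ℕ → ℕ
  | var _, B => B
  | const c, _ => c
  | add a b, B => valueBound a B + valueBound b B
  | sub a _, B => valueBound a B
  | mul a b, B => valueBound a B * valueBound b B
  | bit _, _ => 1
  | sum _ b e, B => valueBound b B * valueBound e (B + valueBound b B)

/-- A bound for the cost of an expression if its variables have the values at most `B`. -/
def costBound : Expr → ℕ → ℕ
  | var _, _ => 2
  | const _, _ => 1
  | add a b, B => costBound a B + costBound b B + 1
  | sub a b, B => costBound a B + costBound b B + 1
  | mul a b, B => costBound a B + costBound b B + valueBound a B * 3 + 5
  | bit a, B => costBound a B + 7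
  | sum _ b e, B =>
    costBound b B + valueBound b B * (costBound e (B + valueBound b B) + 5) + 9

/-- An expression has a fixed number of products and sums. The costs depend on this bound as well,
because products and sums take time proportional to a value. -/
theorem isPoly_valueBound (e : Expr) : IsPoly e.valueBound := by
  induction e with
  | var x => exact .id
  | const c => exact .const c
  | add a b iha ihb => exact iha.add ihb
  | sub a b iha ihb => exact iha
  | mul a b iha ihb => exact iha.mul ihb
  | bit a ih => exact .const 1
  | sum x b e ihb ihe => exact ihb.mul (ihe.comp (.add .id ihb))

theorem isPoly_costBound (e : Expr) : IsPoly e.costBound := by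
  induction e with
  | var x => exact .const 2
  | const c => exact .const 1
  | add a b iha ihb => exact (iha.add ihb).add (.const 1)
  | sub a b iha ihb => exact (iha.add ihb).add (.const 1)
  | mul a b iha ihb =>
    exact ((iha.add ihb).add (a.isPoly_valueBound.mul (.const 3))).add (.const 5)
  | bit a ih => exact ih.add (.const 7)
  | sum x b e ihb ihe =>
    exact (ihb.add (b.isPoly_valueBound.mul
      ((ihe.comp (.add .id b.isPoly_valueBound)).add (.const 5)))).add (.const 9)

theorem eval_cost_le (A : ℕ → ℕ) {n : ℕ} {e : Expr} (he : e.Below n) {s : ℕ → ℕ} {B : ℕ}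
    (h : ∀ r < n, s r ≤ B) : e.eval A s ≤ e.valueBound B ∧ e.cost A s ≤ e.costBound B := by
  induction e generalizing s B with
  | var x =>
    simp only [Below, decide_eq_true_eq] at he
    exact ⟨h x he, le_rfl⟩
  | const c => exact ⟨le_rfl, le_rfl⟩
  | add a b iha ihb =>
    simp only [Below, Bool.and_eq_true] at he
    have := iha he.1 h
    have := ihb he.2 h
    simp only [eval, cost, valueBound, costBound]
    omega
  | sub a b iha ihb =>
    simp only [Below, Bool.and_eq_true] at he
    have := iha he.1 h
    have := ihb he.2 h
    simp only [eval, cost, valueBound, costBound]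
    omega
  | mul a b iha ihb =>
    simp only [Below, Bool.and_eq_true] at he
    have h₁ := iha he.1 h
    have h₂ := ihb he.2 h
    simp only [eval, cost, valueBound, costBound]
    exact ⟨Nat.mul_le_mul h₁.1 h₂.1, by omega⟩
  | bit a ih =>
    have := ih he h
    simp only [eval, cost, valueBound, costBound]
    refine ⟨by split_ifs <;> omega, by omega⟩
  | sum x b e ihb ihe =>
    simp only [Below, Bool.and_eq_true, decide_eq_true_eq] at he
    have h₁ := ihb he.1.2 h
    have h₂ : ∀ i ∈ Finset.range (b.eval A s), e.eval A (Function.update s x i) ≤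
        e.valueBound (B + b.valueBound B) ∧ e.cost A (Function.update s x i) ≤
        e.costBound (B + b.valueBound B) := by
      intro i hi
      rw [Finset.mem_range] at hi
      refine ihe he.2 fun r hr => ?_
      by_cases hrx : r = x
      · simp only [hrx, Function.update_self]; omega
      · simp only [ne_eq, hrx, not_false_eq_true, Function.update_of_ne]
        have := h r hr
        omega
    simp only [eval, cost, valueBound, costBound]
    constructor
    · refine (Finset.sum_le_card_nsmul _ _ _ fun i hi => (h₂ i hi).1).trans ?_
      rw [Finset.card_range, smul_eq_mul]
      exact Nat.mul_le_mul_right _ h₁.1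
    · have h₃ := Finset.sum_le_card_nsmul _ _ (e.costBound (B + b.valueBound B) + 5)
        fun i hi => Nat.add_le_add_right (h₂ i hi).2 5
      rw [Finset.card_range, smul_eq_mul] at h₃
      have h₄ := h₃.trans (Nat.mul_le_mul_right _ h₁.1)
      omega

end Expr

end RAM

namespace RAM

/-! ## Programs that compute an output string from expressions -/

/-- A program that sets the registers `1, …, n` to `0`. -/
def clear : ℕ → Prog
  | 0 => .skip
  | n + 1 => .seq (clear n) (.const (n + 1) 0)

theorem clear_exec (n : ℕ) (s : State) : ∃ s', Exec (clear n) s (n + 1) s' ∧ s'.arr = s.arr ∧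
    s'.reg 0 = s.reg 0 ∧ ∀ r, 0 < r → r ≤ n → s'.reg r = 0 := by
  induction n with
  | zero => exact ⟨s, .skip s, rfl, rfl, fun r h₁ h₂ => by omega⟩
  | succ n ih =>
    obtain ⟨s', h, harr, h₀, hr⟩ := ih
    refine ⟨_, .seq h (.const _ _ _), harr, by simp [State.setReg, h₀], fun r h₁ h₂ => ?_⟩
    by_cases hrn : r = n + 1
    · simp [State.setReg, hrn]
    · simp [State.setReg, hrn, hr r h₁ (by omega)]

/-- A program that copies the string in array `0` to array `1` and puts its length into register
`1`, which has to be `0` in the beginning; it uses the registers `t` and `t + 1`. -/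
def readString (t : ℕ) : Prog :=
  .seq (.const (t + 1) 1) (.seq (.load t 0 1)
    (.loop t (.seq (.store 1 1 t) (.seq (.add 1 1 (t + 1)) (.load t 0 1)))))

theorem symbol_getElem?_eq_zero_iff {y : List Bool} {i : ℕ} : symbol y[i]? = 0 ↔ y.length ≤ i := by
  rw [← List.getElem?_eq_none_iff]
  rcases y[i]? with - | (- | -) <;> simp [symbol]

theorem readString_exec {t : ℕ} (ht : 1 < t) {s : State} {y : List Bool} {k : ℕ}
    (hs : IsOutput s y k) (h₁ : s.reg 1 = 0) :
    ∃ n s', Exec (readString t) s n s' ∧ n ≤ y.length * 4 + 3 ∧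
      (∀ i < y.length, s'.arr 1 i = symbol y[i]?) ∧ s'.reg 1 = y.length ∧
      ∀ r < t, r ≠ 1 → s'.reg r = s.reg r := by
  obtain ⟨n, s', h, hn, -, hA, -, -, hr₁, hr⟩ := Exec.loop_count (r := t)
    (p := .seq (.store 1 1 t) (.seq (.add 1 1 (t + 1)) (.load t 0 1))) (N := y.length)
    (c := fun _ => 3)
    (I := fun i s' => s'.arr 0 = s.arr 0 ∧ (∀ j < i, s'.arr 1 j = symbol y[j]?) ∧
      s'.reg t = symbol y[i]? ∧ s'.reg (t + 1) = 1 ∧ s'.reg 1 = i ∧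
      ∀ r < t, r ≠ 1 → s'.reg r = s.reg r)
    (s := (s.setReg (t + 1) 1).setReg t (s.arr 0 0))
    (by
      rintro i hi s' ⟨ha, hA, hc₁, hc₂, hc₃, hc₄⟩
      refine ⟨?_, _, _, .seq (.store _ _ _ _) (.seq (.add _ _ _ _) (.load _ _ _ _)), le_rfl,
        ?_, ?_, ?_, ?_, ?_, ?_⟩
      · rw [hc₁, Ne, symbol_getElem?_eq_zero_iff]
        omega
      · simp [State.setReg, State.setArr, ha]
      · intro j hj
        by_cases hji : j = i
        · simp [State.setReg, State.setArr, hji, hc₃, hc₁]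
        · simp [State.setReg, State.setArr, hji, hc₃, hA j (by omega)]
      · simp [State.setReg, State.setArr, ha, hc₂, hc₃, hs.2 (i + 1) hi]
      · simp [State.setReg, State.setArr, hc₂, show t ≠ 0 by omega]
      · simp [State.setReg, State.setArr, hc₂, hc₃, show 1 ≠ t by omega]
      · intro r hrt hr1
        simp [State.setReg, State.setArr, hc₄ r hrt hr1, hrt.ne, hr1])
    (by
      rintro s' ⟨-, -, h, -⟩
      rw [h, symbol_getElem?_eq_zero_iff])
    (by
      refine ⟨rfl, by simp, ?_, ?_, ?_, ?_⟩
      · simp [State.setReg, hs.2 0 (Nat.zero_le _)]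
      · simp [State.setReg]
      · simp [State.setReg, h₁, show 1 ≠ t by omega, show t ≠ 0 by omega]
      · intro r hrt hr1
        simp [State.setReg, hrt.ne, show r ≠ t + 1 by omega])
  have hload := Exec.load (s.setReg (t + 1) 1) t 0 1
  rw [show (s.setReg (t + 1) 1).reg 1 = 0 by simp [State.setReg, h₁, show t ≠ 0 by omega]] at hload
  refine ⟨_, s', .seq (.const _ _ _) (.seq hload h), ?_, hA, hr₁, hr⟩
  simp at hn
  omega

/-- A program that replaces an input by a string of the length `len`, with the bits that `bit`
gives for the values of the variable `2` below `len`, and the parameter `par`. The variable `0` is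
the given parameter, and the variable `1` is the length of the given string; there are `V`
variables. -/
def rewrite (V : ℕ) (par len bit : Expr) : Prog :=
  .seq (clear V) (.seq (readString V) (.seq (compile par V) (.seq (compile len (V + 1))
    (.seq (.loop (V + 1) (.seq (compile bit (V + 2)) (.seq
      (.cond (V + 2) (.const (V + 2) 2) (.const (V + 2) 1))
        (.seq (.store 0 2 (V + 2)) (.seq (.const (V + 2) 1) (.seq (.add 2 2 (V + 2))
          (.sub (V + 1) (V + 1) (V + 2))))))))
      (.seq (.const (V + 1) 0) (.seq (.store 0 2 (V + 1)) (copy 0 V)))))))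

/-- The values of the variables for the parameter `k`, the length `L`, and the position `i`. -/
def inputEnv (k L i : ℕ) : ℕ → ℕ
  | 0 => k
  | 1 => L
  | 2 => i
  | _ => 0

theorem inputEnv_le {k L i : ℕ} (r : ℕ) : inputEnv k L i r ≤ k + L + i := by
  rcases r with - | - | - | r <;> simp only [inputEnv] <;> omega

/-- A bound for the running time of `rewrite`, in terms of the sum of the length and the
parameter. -/
def rewriteBound (V : ℕ) (par len bit : Expr) (B : ℕ) : ℕ :=
  B * 4 + V + 10 + par.costBound B + len.costBound B +
    len.valueBound B * (bit.costBound (B + len.valueBound B) + 10)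

theorem isPoly_rewriteBound (V : ℕ) (par len bit : Expr) :
    IsPoly (rewriteBound V par len bit) :=
  (((((IsPoly.id.mul (.const 4)).add (.const V)).add (.const 10)).add
    par.isPoly_costBound).add len.isPoly_costBound).add (len.isPoly_valueBound.mul
      ((bit.isPoly_costBound.comp (.add .id len.isPoly_valueBound)).add (.const 10)))

/-- The initial state may be what another program left behind. So the registers are cleared, and the
memory `A` read by the expressions is known only on the length of the string. The string is moved to
array `1` because array `0` is overwritten while the bits still depend on it. -/
theorem rewrite_exec {V : ℕ} (hV : 2 < V) {par len bit : Expr} (hpar : par.Below V)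
    (hlen : len.Below V) (hbit : bit.Below V) {s : State} {y : List Bool} {k : ℕ}
    (hs : IsOutput s y k) :
    ∃ n s' A, Exec (rewrite V par len bit) s n s' ∧
      n ≤ rewriteBound V par len bit (k + y.length) ∧
      (∀ i < y.length, A i = symbol y[i]?) ∧
      s'.reg 0 = par.eval A (inputEnv k y.length 0) ∧
      s'.arr 0 (len.eval A (inputEnv k y.length 0)) = 0 ∧
      ∀ i < len.eval A (inputEnv k y.length 0),
        s'.arr 0 i = if bit.eval A (inputEnv k y.length i) = 0 then 1 else 2 := by
  obtain ⟨s₁, h₁, ha₁, h₁0, h₁r⟩ := clear_exec V s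
  have hs₁ : IsOutput s₁ y k := ⟨h₁0.trans hs.1, fun i hi => by rw [ha₁]; exact hs.2 i hi⟩
  obtain ⟨n₂, s₂, h₂, hn₂, hA, h₂1, h₂r⟩ :=
    readString_exec (t := V) (by omega) hs₁ (h₁r 1 (by omega) (by omega))
  set A := s₂.arr 1 with hA'
  set L := y.length
  have henv₂ : ∀ r < V, s₂.reg r = inputEnv k L 0 r := by
    intro r hr
    rcases r with - | - | r
    · rw [h₂r 0 hr (by omega), hs₁.1]; rfl
    · exact h₂1
    · rw [h₂r _ hr (by omega), h₁r _ (by omega) hr.le]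
      rcases r with - | r <;> rfl
  obtain ⟨n₃, s₃, h₃, hn₃, ha₃, hv₃, hr₃⟩ := compile_exec hpar s₂
  have hc₃ := par.eval_cost_congr A hpar henv₂
  obtain ⟨n₄, s₄, h₄, hn₄, ha₄, hv₄, hr₄⟩ :=
    compile_exec (Expr.Below.mono (Nat.le_succ V) hlen) s₃
  have hc₄ := len.eval_cost_congr A hlen (s := s₃.reg) (s' := inputEnv k L 0)
    fun r hr => (hr₃ r hr).trans (henv₂ r hr)
  rw [ha₃, ← hA'] at hv₄ hn₄
  rw [← hA'] at hv₃ hn₃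
  rw [hc₃.1] at hv₃
  rw [hc₃.2] at hn₃
  rw [hc₄.1] at hv₄
  rw [hc₄.2] at hn₄
  set N := len.eval A (inputEnv k L 0) with hN
  have hB : ∀ i, ∀ r < V, inputEnv k L i r ≤ k + L + i := fun i r _ => inputEnv_le r
  have hp := (Expr.eval_cost_le A hpar (hB 0)).2
  have hl := Expr.eval_cost_le A hlen (hB 0)
  rw [Nat.add_zero] at hp hl
  have hloop : ∃ n s', Exec (.loop (V + 1) (.seq (compile bit (V + 2)) (.seq
      (.cond (V + 2) (.const (V + 2) 2) (.const (V + 2) 1))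
        (.seq (.store 0 2 (V + 2)) (.seq (.const (V + 2) 1) (.seq (.add 2 2 (V + 2))
          (.sub (V + 1) (V + 1) (V + 2)))))))) s₄ n s' ∧
      n ≤ ∑ i ∈ Finset.range N, (bit.costBound (k + L + len.valueBound (k + L)) + 6 + 1) + 1 ∧
      s'.arr 1 = A ∧ s'.reg (V + 1) = N - N ∧ s'.reg V = par.eval A (inputEnv k L 0) ∧
        (∀ r < V, s'.reg r = inputEnv k L N r) ∧
        ∀ j < N, s'.arr 0 j = if bit.eval A (inputEnv k L j) = 0 then 1 else 2 := by
    refine Exec.loop_count (c := fun _ => bit.costBound (k + L + len.valueBound (k + L)) + 6)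
      (I := fun i s' => s'.arr 1 = A ∧ s'.reg (V + 1) = N - i ∧
        s'.reg V = par.eval A (inputEnv k L 0) ∧ (∀ r < V, s'.reg r = inputEnv k L i r) ∧
        ∀ j < i, s'.arr 0 j = if bit.eval A (inputEnv k L j) = 0 then 1 else 2) ?_ ?_ ?_
    · rintro i hi s' ⟨ha', hc, hp', he, hout⟩
      obtain ⟨n₅, s₅, h₅, hn₅, ha₅, hv₅, hr₅⟩ :=
        compile_exec (Expr.Below.mono (show V ≤ V + 2 by omega) hbit) s'
      have hc₅ := bit.eval_cost_congr A hbit he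
      rw [ha', hc₅.1] at hv₅
      rw [ha', hc₅.2] at hn₅
      have hle := (Expr.eval_cost_le A hbit (s := inputEnv k L i) (B := k + L + len.valueBound (k + L))
        fun r hr => (hB i r hr).trans (by omega)).2
      have hcond : Exec (.cond (V + 2) (.const (V + 2) 2) (.const (V + 2) 1)) s₅ 2
          (s₅.setReg (V + 2) (if bit.eval A (inputEnv k L i) = 0 then 1 else 2)) := by
        split_ifs with h
        · exact .condFalse (by rw [hv₅, h]) (.const _ _ _)
        · exact .condTrue (by rwa [hv₅]) (.const _ _ _)
      have h2 : s₅.reg 2 = i := by rw [hr₅ 2 (by omega), he 2 hV]; rfl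
      refine ⟨by omega, _, _, .seq h₅ (.seq hcond (.seq (.store _ _ _ _) (.seq (.const _ _ _)
        (.seq (.add _ _ _ _) (.sub _ _ _ _))))), by omega, ?_, ?_, ?_, ?_, ?_⟩
      · simp [State.setReg, State.setArr, ha₅, ha']
      · simp [State.setReg, State.setArr, hr₅ (V + 1) (by omega), hc, show V + 1 ≠ 2 by omega,
          show V ≠ 0 by omega]
        omega
      · simp [State.setReg, State.setArr, hr₅ V (by omega), hp', show V ≠ 2 by omega]
      · intro r hr
        by_cases hr2 : r = 2
        · subst hr2
          simp [State.setReg, State.setArr, h2, show 2 ≠ V + 1 by omega, show V ≠ 0 by omega,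
            inputEnv]
        · have : inputEnv k L (i + 1) r = inputEnv k L i r := by
            rcases r with - | - | - | r
            · rfl
            · rfl
            · omega
            · rfl
          simp [State.setReg, State.setArr, hr2, show r ≠ V + 1 by omega, show r ≠ V + 2 by omega,
            hr₅ r (by omega), he r hr, this]
      · intro j hj
        by_cases hji : j = i
        · simp [State.setReg, State.setArr, hji, h2, show V ≠ 0 by omega]
        · simp [State.setReg, State.setArr, hji, h2, show V ≠ 0 by omega, ha₅,
            hout j (by omega)]
    · rintro s' ⟨-, h, -⟩
      omega
    · refine ⟨by rw [ha₄, ha₃], by rw [hv₄, Nat.sub_zero], by rw [hr₄ V (by omega), hv₃],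
        fun r hr => ?_, by simp⟩
      rw [hr₄ r (by omega), hr₃ r hr, henv₂ r hr]
  obtain ⟨n₅, s₅, h₅, hn₅, -, -, hp₅, he₅, hout⟩ := hloop
  -- Register `2` has counted up to `N`, so the blank goes right behind the output.
  have h2 : Function.update s₅.reg (V + 1) 0 2 = N := by
    rw [Function.update_of_ne (by omega), he₅ 2 hV]
    rfl
  refine ⟨_, _, A, .seq h₁ (.seq h₂ (.seq h₃ (.seq h₄ (.seq h₅ (.seq (.const _ _ _)
    (.seq (.store _ _ _ _) (Exec.copy _ (by omega)))))))), ?_, hA, ?_, ?_, ?_⟩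
  · simp only [Finset.sum_const, Finset.card_range, smul_eq_mul] at hn₅
    have h₆ : N * (bit.costBound (k + L + len.valueBound (k + L)) + 6 + 1) ≤ len.valueBound (k + L) *
        (bit.costBound (k + L + len.valueBound (k + L)) + 10) :=
      Nat.mul_le_mul hl.1 (by omega)
    simp only [rewriteBound]
    omega
  · simp [State.setReg, State.setArr, hp₅]
  · rw [← hN]
    simp [State.setReg, State.setArr, h2]
  · intro i hi
    rw [← hN] at hi
    simp [State.setReg, State.setArr, h2, hi.ne, hout i hi]

end RAM

namespace RAM.Expr

/-! ## Bounded formulas as expressions -/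

/-- An expression, read as a formula, is true if its value is not `0`. -/
def Holds (A : ℕ → ℕ) (e : Expr) (s : ℕ → ℕ) : Prop := e.eval A s ≠ 0

/-- The formula `a < b`. -/
def lt (a b : Expr) : Expr := sub b a

/-- The formula `a = b`. -/
def eq (a b : Expr) : Expr := sub (const 1) (add (sub a b) (sub b a))

/-- Conjunction. -/
def and (a b : Expr) : Expr := mul a b

/-- Disjunction. -/
def or (a b : Expr) : Expr := add a b

/-- Negation. -/
def not (a : Expr) : Expr := sub (const 1) a

/-- Bounded existential quantification. -/
def ex (x : ℕ) (b e : Expr) : Expr := sum x b e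

/-- Bounded universal quantification. -/
def all (x : ℕ) (b e : Expr) : Expr := not (ex x b (not e))

section

variable {A : ℕ → ℕ} {a b e : Expr} {x : ℕ} {s : ℕ → ℕ}

theorem holds_lt : (lt a b).Holds A s ↔ a.eval A s < b.eval A s := by
  simp only [Holds, lt, eval]; omega

theorem holds_eq : (eq a b).Holds A s ↔ a.eval A s = b.eval A s := by
  simp only [Holds, eq, eval]; omega

theorem eval_eq : (eq a b).eval A s = if a.eval A s = b.eval A s then 1 else 0 := by
  simp only [eq, eval]; split_ifs <;> omega

theorem holds_and : (and a b).Holds A s ↔ a.Holds A s ∧ b.Holds A s := by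
  simp only [Holds, and, eval, ne_eq, Nat.mul_eq_zero]; tauto

theorem holds_or : (or a b).Holds A s ↔ a.Holds A s ∨ b.Holds A s := by
  simp only [Holds, or, eval]; omega

theorem holds_not : (not a).Holds A s ↔ ¬ a.Holds A s := by
  simp only [Holds, not, eval]; omega

theorem holds_bit : (bit a).Holds A s ↔ A (a.eval A s) = 2 := by
  simp [Holds, eval]

theorem holds_ex : (ex x b e).Holds A s ↔
    ∃ i < b.eval A s, e.Holds A (Function.update s x i) := by
  simp [Holds, ex, eval, Finset.sum_eq_zero_iff]

theorem holds_all : (all x b e).Holds A s ↔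
    ∀ i < b.eval A s, e.Holds A (Function.update s x i) := by
  simp [all, holds_not, holds_ex]

end

open ParamComplexity Digraph

/-! ## The expressions of the reduction

The variables `0` and `1` stand for the parameter and for the length of the string. -/

/-- The number of variables of the formula. -/
def numVarsExpr : Expr :=
  sum 20 (add (var 1) (const 1)) (mul
    (eq (mul (mul (var 20) (const 2)) (mul (var 20) (const 2))) (var 1)) (var 20))

/-- The number of rows of the grid. -/
def rowsExpr : Expr := add (var 0) (const 2)

/-- The number of values. -/
def valuesExpr : Expr := mul (add numVarsExpr (const 3)) (add numVarsExpr (const 3))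

/-- The number of positions of a row of the grid. -/
def positionsExpr : Expr := mul valuesExpr rowsExpr

/-- The number of vertices of the grid. -/
def gridSizeExpr : Expr :=
  add (add (mul rowsExpr rowsExpr) (mul rowsExpr rowsExpr))
    (mul (mul rowsExpr positionsExpr) (const 2))

/-- The number of vertices of the Eulerian extension. -/
def eulerSizeExpr : Expr :=
  add gridSizeExpr (add (mul gridSizeExpr gridSizeExpr)
    (add (mul gridSizeExpr gridSizeExpr) (const 2)))

/-- The formula `FalsifiedBy a b w s`. -/
def falsifiedExpr (a b w s : Expr) : Expr :=
  or (and (eq s (const 0)) (and (lt a (add w (const 1))) (lt (add w (const 1)) b)))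
    (and (eq s (const 1)) (eq (add w (const 1)) a))

/-- The formula that says that there is a clause at the position `p`. -/
def clauseExpr (p : Expr) : Expr := and (lt p (var 1)) (bit p)

/-- The compatibility of the values `10` and `11` of the rows `7` and `8`. -/
def compatExpr : Expr :=
  and (eq (mul (mul numVarsExpr (const 2)) (mul numVarsExpr (const 2))) (var 1))
  (ex 12 (add numVarsExpr (const 3)) (ex 13 (add numVarsExpr (const 3))
  (ex 14 (add numVarsExpr (const 3)) (ex 15 (add numVarsExpr (const 3))
  (and (eq (var 10) (add (mul (var 12) (add numVarsExpr (const 3))) (var 13)))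
  (and (eq (var 11) (add (mul (var 14) (add numVarsExpr (const 3))) (var 15)))
  (and (lt (var 12) (var 13)) (and (lt (var 14) (var 15))
  (and (or (not (eq (var 7) (const 0))) (eq (var 12) (const 0)))
  (and (or (not (eq (var 8) (add (var 0) (const 1)))) (eq (var 14) (add numVarsExpr (const 1))))
  (and (or (not (eq (var 8) (add (var 7) (const 1)))) (eq (var 13) (var 14)))
  (all 16 numVarsExpr (all 17 (const 2) (all 18 numVarsExpr (all 19 (const 2)
    (or (not (clauseExpr (add (mul (add (mul (var 16) (const 2)) (var 17))
        (mul numVarsExpr (const 2))) (add (mul (var 18) (const 2)) (var 19)))))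
      (not (and
        (or (falsifiedExpr (var 12) (var 13) (var 16) (var 17))
          (falsifiedExpr (var 14) (var 15) (var 16) (var 17)))
        (or (falsifiedExpr (var 12) (var 13) (var 18) (var 19))
          (falsifiedExpr (var 14) (var 15) (var 18) (var 19)))))))))))))))))))))

/-- The number of a root. -/
def rootExpr (i j : Expr) : Expr := add (mul i rowsExpr) j

/-- The number of a mate. -/
def mateExpr (i j : Expr) : Expr := add (mul rowsExpr rowsExpr) (add (mul i rowsExpr) j)

/-- The number of a node. -/
def nodeExpr (i t l : Expr) : Expr :=
  add (add (mul rowsExpr rowsExpr) (mul rowsExpr rowsExpr))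
    (add (mul (add (mul i positionsExpr) t) (const 2)) l)

/-- The formula `x = p ∧ y = q`. -/
def pairExpr (x p y q : Expr) : Expr := and (eq x p) (eq y q)

/-- The formula that says that there is an arc of the grid from `5` to `6`. -/
def gridArcExpr : Expr :=
  ex 7 rowsExpr (ex 8 rowsExpr (ex 9 positionsExpr (ex 10 valuesExpr (ex 11 valuesExpr
  (or (pairExpr (var 5) (rootExpr (var 7) (var 7)) (var 6) (nodeExpr (var 7) (const 0) (const 0)))
  (or (and (pairExpr (var 5) (nodeExpr (var 7) (var 9) (const 1))
      (var 6) (rootExpr (var 7) (var 7))) (eq (add (var 9) (const 1)) positionsExpr))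
  (or (and (pairExpr (var 5) (nodeExpr (var 7) (var 9) (const 0))
      (var 6) (nodeExpr (var 7) (add (var 9) (const 1)) (const 0)))
      (lt (add (var 9) (const 1)) positionsExpr))
  (or (and (pairExpr (var 5) (nodeExpr (var 7) (var 9) (const 1))
      (var 6) (nodeExpr (var 7) (add (var 9) (const 1)) (const 1)))
      (lt (add (var 9) (const 1)) positionsExpr))
  (or (and (pairExpr (var 5) (nodeExpr (var 7) (var 9) (const 0))
      (var 6) (nodeExpr (var 7) (mul (add (var 10) (const 2)) rowsExpr) (const 1)))
      (and (lt (add (var 10) (const 2)) valuesExpr)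
        (eq (add (var 9) (const 1)) (mul (add (var 10) (const 1)) rowsExpr))))
  (or (pairExpr (var 5) (nodeExpr (var 7) (var 9) (const 0))
      (var 6) (nodeExpr (var 7) (var 9) (const 1)))
  (or (and (pairExpr (var 5) (rootExpr (var 7) (var 8))
      (var 6) (nodeExpr (var 7) (add (mul (var 10) rowsExpr) (var 8)) (const 0)))
      (lt (var 7) (var 8)))
  (or (and (pairExpr (var 5) (nodeExpr (var 7) (add (mul (var 10) rowsExpr) (var 8)) (const 1))
      (var 6) (nodeExpr (var 8) (add (mul (var 11) rowsExpr) (var 7)) (const 0)))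
      (and (lt (var 7) (var 8)) compatExpr))
  (or (and (pairExpr (var 5) (nodeExpr (var 8) (add (mul (var 11) rowsExpr) (var 7)) (const 1))
      (var 6) (rootExpr (var 7) (var 8))) (lt (var 7) (var 8)))
  (or (and (pairExpr (var 5) (rootExpr (var 7) (var 8)) (var 6) (mateExpr (var 7) (var 8)))
      (lt (var 8) (var 7)))
    (and (pairExpr (var 5) (mateExpr (var 7) (var 8)) (var 6) (rootExpr (var 7) (var 8)))
      (lt (var 8) (var 7)))))))))))))))))

/-- The number of the hub. -/
def hubExpr : Expr :=
  add gridSizeExpr (add (mul gridSizeExpr gridSizeExpr) (mul gridSizeExpr gridSizeExpr))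

/-- The number of the vertex on the path to the hub for the pair `(5, 6)`. -/
def toHubExpr : Expr := add gridSizeExpr (add (mul (var 5) gridSizeExpr) (var 6))

/-- The number of the vertex on the path from the hub for the pair `(5, 6)`. -/
def fromHubExpr : Expr :=
  add gridSizeExpr (add (mul gridSizeExpr gridSizeExpr) (add (mul (var 5) gridSizeExpr) (var 6)))

/-- The formula that says that `5` and `6` are equal or that there is an arc from `5` to `6`. -/
def linkedExpr : Expr := or (eq (var 5) (var 6)) gridArcExpr

/-- The formula that says that there is an arc of the Eulerian extension from `3` to `4`. -/
def eulerArcExpr : Expr :=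
  ex 5 gridSizeExpr (ex 6 gridSizeExpr
  (or (and (pairExpr (var 3) (var 5) (var 4) (var 6)) gridArcExpr)
  (or (and (pairExpr (var 3) (var 6) (var 4) toHubExpr) linkedExpr)
  (or (pairExpr (var 3) toHubExpr (var 4) hubExpr)
  (or (and (pairExpr (var 3) hubExpr (var 4) toHubExpr) (not linkedExpr))
  (or (pairExpr (var 3) hubExpr (var 4) fromHubExpr)
  (or (and (pairExpr (var 3) fromHubExpr (var 4) (var 5)) linkedExpr)
  (or (and (pairExpr (var 3) fromHubExpr (var 4) hubExpr) (not linkedExpr))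
  (or (pairExpr (var 3) hubExpr (var 4) (add hubExpr (const 1)))
    (pairExpr (var 3) (add hubExpr (const 1)) (var 4) hubExpr))))))))))

/-- The formula that says that the adjacency matrix has a `1` at the position `2`. -/
def entryExpr : Expr :=
  ex 3 eulerSizeExpr (ex 4 eulerSizeExpr
    (and (eq (var 2) (add (mul (var 3) eulerSizeExpr) (var 4))) eulerArcExpr))

section

variable {A : ℕ → ℕ} {s : ℕ → ℕ}

theorem eval_numVarsExpr : numVarsExpr.eval A s = numVars (s 1) := by
  simp [numVarsExpr, eval, eval_eq, numVars]

theorem eval_rowsExpr : rowsExpr.eval A s = s 0 + 2 := rfl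

theorem eval_valuesExpr : valuesExpr.eval A s = domainSize (s 1) := by
  simp only [valuesExpr, eval, eval_numVarsExpr, domainSize]

theorem eval_positionsExpr :
    positionsExpr.eval A s = domainSize (s 1) * (s 0 + 2) := by
  simp only [positionsExpr, eval, eval_valuesExpr, eval_rowsExpr]

theorem eval_gridSizeExpr :
    gridSizeExpr.eval A s = gridSize (s 0 + 2) (domainSize (s 1)) := by
  simp only [gridSizeExpr, eval, eval_positionsExpr, eval_rowsExpr, gridSize]

theorem eval_eulerSizeExpr :
    eulerSizeExpr.eval A s = eulerSize (gridSize (s 0 + 2) (domainSize (s 1))) := by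
  simp only [eulerSizeExpr, eval, eval_gridSizeExpr]

theorem holds_falsifiedExpr {a b w e : Expr} : (falsifiedExpr a b w e).Holds A s ↔
    FalsifiedBy (a.eval A s) (b.eval A s) (w.eval A s) (e.eval A s) := by
  simp only [falsifiedExpr, holds_or, holds_and, holds_eq, holds_lt, eval, FalsifiedBy]

theorem holds_pairExpr {x p y q : Expr} : (pairExpr x p y q).Holds A s ↔
    x.eval A s = p.eval A s ∧ y.eval A s = q.eval A s := by
  simp only [pairExpr, holds_and, holds_eq]

variable {y : List Bool}

/-- The comparison with the length is essential: cells of array `1` behind the string may hold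
anything. -/
theorem holds_clauseExpr (hA : ∀ i < y.length, A i = symbol y[i]?) (hs : s 1 = y.length)
    {p : Expr} : (clauseExpr p).Holds A s ↔ IsClauseAt y (p.eval A s) := by
  simp only [clauseExpr, holds_and, holds_lt, holds_bit, eval, hs, IsClauseAt]
  constructor
  · rintro ⟨h, h'⟩
    rw [hA _ h] at h'
    rcases e : y[p.eval A s]? with - | (- | -) <;> simp_all [symbol]
  · intro h
    obtain ⟨hlt, -⟩ := List.getElem?_eq_some_iff.1 h
    exact ⟨hlt, by rw [hA _ hlt, h]; rfl⟩

/-- The expression has the shape of the definition. Nested quantifiers use different variables, so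
none overwrites another. -/
theorem holds_compatExpr (hA : ∀ i < y.length, A i = symbol y[i]?) (hs : s 1 = y.length) :
    compatExpr.Holds A s ↔ InstanceCompat y (s 0) (s 7) (s 10) (s 8) (s 11) := by
  have hcl : ∀ {s : ℕ → ℕ} {p : Expr}, s 1 = y.length →
      ((clauseExpr p).Holds A s ↔ IsClauseAt y (p.eval A s)) := fun h => holds_clauseExpr hA h
  simp [compatExpr, InstanceCompat, GapCompat, holds_and, holds_or, holds_not, holds_eq, holds_lt,
    holds_ex, holds_all, eval, eval_numVarsExpr, holds_falsifiedExpr, hcl, hs, imp_iff_not_or]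

theorem holds_gridArcExpr (hA : ∀ i < y.length, A i = symbol y[i]?) (hs : s 1 = y.length) :
    gridArcExpr.Holds A s ↔ GridArc (s 0 + 2) (domainSize y.length) (InstanceCompat y (s 0))
      (s 5) (s 6) := by
  have hc : ∀ {s : ℕ → ℕ}, s 1 = y.length →
      (compatExpr.Holds A s ↔ InstanceCompat y (s 0) (s 7) (s 10) (s 8) (s 11)) :=
    fun h => holds_compatExpr hA h
  simp [gridArcExpr, GridArc, holds_and, holds_or, holds_eq, holds_lt, holds_ex, holds_pairExpr,
    eval, eval_rowsExpr, eval_positionsExpr, eval_valuesExpr, rootExpr, mateExpr, nodeExpr, hc, hs,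
    rootCode, mateCode, nodeCode]

theorem holds_eulerArcExpr (hA : ∀ i < y.length, A i = symbol y[i]?) (hs : s 1 = y.length) :
    eulerArcExpr.Holds A s ↔ EulerArc (gridSize (s 0 + 2) (domainSize y.length))
      (GridArc (s 0 + 2) (domainSize y.length) (InstanceCompat y (s 0))) (s 3) (s 4) := by
  have hg : ∀ {s : ℕ → ℕ}, s 1 = y.length →
      (gridArcExpr.Holds A s ↔ GridArc (s 0 + 2) (domainSize y.length) (InstanceCompat y (s 0))
        (s 5) (s 6)) := fun h => holds_gridArcExpr hA h
  simp [eulerArcExpr, EulerArc, holds_and, holds_or, holds_not, holds_eq, holds_ex,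
    holds_pairExpr, eval, eval_gridSizeExpr, toHubExpr, fromHubExpr, hubExpr, linkedExpr, hg, hs]

theorem holds_entryExpr (hA : ∀ i < y.length, A i = symbol y[i]?) (hs : s 1 = y.length) {N : ℕ}
    (hN : N = eulerSize (gridSize (s 0 + 2) (domainSize y.length))) :
    entryExpr.Holds A s ↔ ∃ u < N, ∃ v < N, s 2 = u * N + v ∧
      EulerArc (gridSize (s 0 + 2) (domainSize y.length))
        (GridArc (s 0 + 2) (domainSize y.length) (InstanceCompat y (s 0))) u v := by
  have he : ∀ {s : ℕ → ℕ}, s 1 = y.length →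
      (eulerArcExpr.Holds A s ↔ EulerArc (gridSize (s 0 + 2) (domainSize y.length))
        (GridArc (s 0 + 2) (domainSize y.length) (InstanceCompat y (s 0))) (s 3) (s 4)) :=
    fun h => holds_eulerArcExpr hA h
  subst hN
  simp [entryExpr, holds_and, holds_eq, holds_ex, eval, eval_eulerSizeExpr, he, hs]

end

theorem below_eulerSizeExpr : (mul eulerSizeExpr eulerSizeExpr).Below 21 := by decide

theorem below_entryExpr : entryExpr.Below 21 := by decide

end RAM.Expr

namespace RAM

/-! ## The length of an output -/

theorem Exec.exists_finset {p : Prog} {s s' : State} {t : ℕ} (h : Exec p s t s') :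
    ∃ F : Finset ℕ, F.card ≤ t ∧ ∀ i ∉ F, s'.arr 0 i = s.arr 0 i := by
  induction h with
  | store s A i r =>
    refine ⟨{s.reg i}, by simp, fun j hj => ?_⟩
    rw [Finset.mem_singleton] at hj
    by_cases hA : A = 0
    · subst hA
      simp [State.setArr, hj]
    · simp [State.setArr, Ne.symm hA]
  | seq _ _ ih ih' | loopStep _ _ _ ih ih' =>
    obtain ⟨F, hF, h⟩ := ih
    obtain ⟨F', hF', h'⟩ := ih'
    refine ⟨F ∪ F', (Finset.card_union_le _ _).trans (by omega), fun i hi => ?_⟩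
    rw [Finset.notMem_union] at hi
    rw [h' i hi.2, h i hi.1]
  | condTrue _ _ ih | condFalse _ _ ih =>
    obtain ⟨F, hF, h⟩ := ih
    exact ⟨F, by omega, h⟩
  | _ => exact ⟨∅, by simp, fun i _ => rfl⟩

/-- Each symbol behind the end of the input had to be written, and a step writes at most one cell.
-/
theorem Exec.length_output_le {p : Prog} {x y : List Bool} {k k' t : ℕ} {s : State}
    (h : Exec p (input x k) t s) (hs : IsOutput s y k') : y.length ≤ x.length + t := by
  obtain ⟨F, hF, h⟩ := h.exists_finset
  have hsub : Finset.range y.length ⊆ Finset.range x.length ∪ F := by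
    intro i hi
    rw [Finset.mem_union]
    by_contra hno
    rw [not_or, Finset.mem_range, not_lt] at hno
    rw [Finset.mem_range] at hi
    have h₁ := h i hno.2
    rw [hs.2 i hi.le, show (input x k).arr 0 i = symbol x[i]? from rfl,
      symbol_getElem?_eq_zero_iff.2 hno.1, symbol_getElem?_eq_zero_iff] at h₁
    omega
  have := (Finset.card_le_card hsub).trans (Finset.card_union_le _ _)
  simp only [Finset.card_range] at this
  omega

end RAM

namespace ParamComplexity

open RAM Digraph

/-! ## The reduction -/

/-- The reduction from Weighted 2-CNF-Satisfiability to disjoint cycles in Euler digraphs. -/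
noncomputable def eulerInstance (w : Instance) : Instance :=
  ((finEuler (w.2 + 2) (domainSize w.1.length) (InstanceCompat w.1 w.2)).encode,
    (w.2 + 2) * (w.2 + 2) + 1)

theorem domainSize_pos (L : ℕ) : 0 < domainSize L := Nat.mul_pos (by omega) (by omega)

theorem eulerInstance_mem_iff (w : Instance) :
    w ∈ weightedTwoCNFSat ↔ eulerInstance w ∈ vertexDisjointCycles := by
  rw [eulerInstance, encode_mem_iff _ (finEuler_loopless (by omega) (domainSize_pos _)),
    finEuler_hasDisjointCycles_iff (by omega) (domainSize_pos _),
    ← mem_weightedTwoCNFSat_iff_hasDisjointCycles]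

theorem eulerInstance_mem_eulerInstances (w : Instance) : eulerInstance w ∈ eulerInstances :=
  ⟨_, _, finEuler_loopless (by omega) (domainSize_pos _),
    finEuler_isEuler (by omega) (domainSize_pos _), rfl⟩

/-- The program that computes the reduction. -/
def eulerProg : Prog :=
  rewrite 21 (.add (.mul Expr.rowsExpr Expr.rowsExpr) (.const 1))
    (.mul Expr.eulerSizeExpr Expr.eulerSizeExpr) Expr.entryExpr

theorem eulerProg_exec : ∃ d, ∀ (y : List Bool) (k : ℕ) (s : State), IsOutput s y k →
    ∃ n s', Exec eulerProg s n s' ∧ n ≤ (k + y.length + 2) ^ d ∧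
      IsOutput s' (eulerInstance (y, k)).1 (eulerInstance (y, k)).2 := by
  obtain ⟨d, hd⟩ := isPoly_rewriteBound 21 (.add (.mul Expr.rowsExpr Expr.rowsExpr) (.const 1))
    (.mul Expr.eulerSizeExpr Expr.eulerSizeExpr) Expr.entryExpr
  refine ⟨d, fun y k s hs => ?_⟩
  obtain ⟨n, s', A, h, hn, hA, h₀, hend, hout⟩ :=
    rewrite_exec (V := 21) (by omega)
      (par := .add (.mul Expr.rowsExpr Expr.rowsExpr) (.const 1)) (by decide)
      Expr.below_eulerSizeExpr Expr.below_entryExpr hs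
  refine ⟨n, s', h, hn.trans (hd _), h₀, ?_⟩
  simp only [Expr.eval, Expr.eval_eulerSizeExpr, inputEnv] at hend hout
  set N := eulerSize (gridSize (k + 2) (domainSize y.length)) with hN
  have hlen : (eulerInstance (y, k)).1.length = N * N := by
    rw [eulerInstance, Digraph.encode, length_encodeMatrix]
  intro i hi
  rw [hlen] at hi
  rcases hi.lt_or_eq with hi | rfl
  · have hpos : 0 < N := Nat.pos_of_ne_zero (by rintro h; simp [h] at hi)
    have hu : i / N < N := Nat.div_lt_of_lt_mul hi
    have hv : i % N < N := Nat.mod_lt _ hpos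
    have hi' : i = (⟨i / N, hu⟩ : Fin N) * N + (⟨i % N, hv⟩ : Fin N) := by
      simp [Nat.div_add_mod']
    have hentry : (Expr.entryExpr.eval A (inputEnv k y.length i) ≠ 0) ↔
        (finEuler (k + 2) (domainSize y.length) (InstanceCompat y k)).Adj
          ⟨i / N, hu⟩ ⟨i % N, hv⟩ := by
      refine (Expr.holds_entryExpr hA rfl hN).trans ⟨?_, fun h => ⟨_, hu, _, hv, hi', h⟩⟩
      rintro ⟨u, hu', v, hv', huv, h⟩
      obtain ⟨rfl, rfl⟩ := mul_add_inj hv hv' (hi'.symm.trans huv)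
      exact h
    rw [hout i hi]
    conv_rhs => rw [hi']
    rw [eulerInstance, Digraph.encode, getElem?_encodeMatrix]
    simp only [← hentry]
    split_ifs with h
    · simp [h, symbol]
    · simp [h, symbol]
  · rw [hend, List.getElem?_eq_none hlen.le]
    rfl

theorem computable_pow {f : ℕ → ℕ} (hf : Computable f) (d : ℕ) :
    Computable fun k => f k ^ d := by
  induction d with
  | zero => simpa using Computable.const 1
  | succ d ih =>
    simp only [pow_succ]
    exact (Primrec.nat_mul.to_comp).comp ih hf

theorem computable_add {f g : ℕ → ℕ} (hf : Computable f) (hg : Computable g) :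
    Computable fun k => f k + g k :=
  (Primrec.nat_add.to_comp).comp hf hg

theorem fptComputable_eulerInstance_comp {R : Instance → Instance} (hR : FPTComputable R)
    {g : ℕ → ℕ} (hg : Computable g) (hle : ∀ (x : List Bool) (k : ℕ), (R (x, k)).2 ≤ g k) :
    FPTComputable (eulerInstance ∘ R) := by
  obtain ⟨p, f, c, hf, hp⟩ := hR
  obtain ⟨d, hd⟩ := eulerProg_exec
  -- The intermediate instance has a parameter at most `g k` and a length at most `|x| + f k * (|x|
  -- + 1) ^ c`. Parameter, length and `2` together are at most `(g k + f k + 3) * (|x| + 1) ^ (c +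
  -- 1)`, whose `d`-th power bounds the second program. The exponent `c + (c + 1) * d` suffices for
  -- both programs.
  refine ⟨.seq p eulerProg, fun k => f k + (g k + f k + 3) ^ d, c + (c + 1) * d,
    computable_add hf (computable_pow (computable_add (computable_add hg hf)
      (Computable.const 3)) d), fun x k => ?_⟩
  obtain ⟨t, s, h, ht, hs⟩ := hp x k
  obtain ⟨n, s', h', hn, hs'⟩ := hd _ _ s hs
  refine ⟨t + n, s', .seq h h', ?_, hs'⟩
  have hlen := h.length_output_le hs
  set X := x.length + 1 with hX
  have hX1 : 1 ≤ X := by omega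
  have hXc : 1 ≤ X ^ c := Nat.one_le_pow _ _ hX1
  have h₁ : t ≤ f k * X ^ (c + (c + 1) * d) :=
    ht.trans (Nat.mul_le_mul_left _ (Nat.pow_le_pow_right hX1 (by omega)))
  have h₂ : (R (x, k)).2 + (R (x, k)).1.length + 2 ≤ (g k + f k + 3) * X ^ (c + 1) := by
    have hkk := hle x k
    have ha : X ≤ X ^ (c + 1) := by
      calc X = X ^ 1 := (pow_one X).symm
        _ ≤ X ^ (c + 1) := Nat.pow_le_pow_right hX1 (by omega)
    have hb : X ^ c ≤ X ^ (c + 1) := Nat.pow_le_pow_right hX1 (by omega)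
    have hc : f k * X ^ c ≤ f k * X ^ (c + 1) := Nat.mul_le_mul_left _ hb
    have hd : g k ≤ g k * X ^ (c + 1) := Nat.le_mul_of_pos_right _ (by omega)
    have he : (g k + f k + 3) * X ^ (c + 1) =
        g k * X ^ (c + 1) + f k * X ^ (c + 1) + 3 * X ^ (c + 1) := by ring
    omega
  have h₃ : n ≤ (g k + f k + 3) ^ d * X ^ (c + (c + 1) * d) := by
    calc n ≤ ((g k + f k + 3) * X ^ (c + 1)) ^ d := hn.trans (Nat.pow_le_pow_left h₂ d)
      _ = (g k + f k + 3) ^ d * X ^ ((c + 1) * d) := by rw [mul_pow, pow_mul]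
      _ ≤ _ := Nat.mul_le_mul_left _ (Nat.pow_le_pow_right hX1 (by omega))
  rw [Nat.add_mul]
  omega

end ParamComplexity

theorem mainTheorem4 :
    ParamComplexity.IsW1HardOn Digraph.vertexDisjointCycles Digraph.eulerInstances := by
  rintro L ⟨R, hR⟩
  obtain ⟨g, hg, hle⟩ := hR.param_le
  refine ⟨ParamComplexity.eulerInstance ∘ R, ⟨fun w => ?_, ?_, ?_⟩, fun w =>
    ParamComplexity.eulerInstance_mem_eulerInstances _⟩
  · exact (hR.mem_iff w).trans (ParamComplexity.eulerInstance_mem_iff _)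
  · exact ParamComplexity.fptComputable_eulerInstance_comp hR.computable hg hle
  · refine ⟨fun k => (g k + 2) ^ 2 + 1, ParamComplexity.computable_add
      (ParamComplexity.computable_pow (ParamComplexity.computable_add hg (Computable.const 2)) 2)
      (Computable.const 1), fun x k => ?_⟩
    have := hle x k
    change ((R (x, k)).2 + 2) * ((R (x, k)).2 + 2) + 1 ≤ (g k + 2) ^ 2 + 1
    rw [pow_two]
    exact Nat.add_le_add_right (Nat.mul_le_mul (by omega) (by omega)) 1
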